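/- Let $K$ be a field (for example $K=\mathbb{C}$, or $K=\mathbb{C}(q,v_1,\dots,v_m)$ for the generic algebra), let $m\ge 0$ and $n\ge 1$ be integers, and let $q,v_1,\dots,v_m\in K$ satisfy $q\neq 0$, $q^2\neq 1$ and - $1+q^2+\dots+q^{2N}\neq 0$ for all integers $0\le N<n$; - $q^{2i}v_j-v_k\neq 0$ for all $j\neq k$ and all integers $i$ with $-n<i<n$; - $v_j\neq 0$ for $j=1,\dots,m$. Let $H(m,1,n)$ be the cyclotomic Hecke algebra over $K$: the associative unital algebra generated by $\tau,\sigma_1,\dots,\sigma_{n-1}$ with relations $\sigma_i\sigma_{i+1}\sigma_i=\sigma_{i+1}\sigma_i\sigma_{i+1}$, $\sigma_i\sigma_j=\sigma_j\sigma_i$ for $|i-j|>1$, $\tau\sigma_1\tau\sigma_1=\sigma_1\tau\sigma_1\tau$, $\tau\sigma_i=\sigma_i\tau$ for $i>1$, $\sigma_i^2=(q-q^{-1})\sigma_i+1$ and $(\tau-v_1)\cdots(\tau-v_m)=0$. Its Jucys–Murphy elements are $J_1=\tau$, $J_{i+1}=\sigma_iJ_i\sigma_i$. A *$C$-representation* is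 a finite-dimensional representation of $H(m,1,n)$ in which every $J_i$ acts diagonalizably and, for every $i=1,\dots,n-1$, the action of the subalgebra generated by $J_i,J_{i+1},\sigma_i$ is completely reducible. Let $\mathrm{Spec}(J_1,\dots,J_n)\subset K^n$ be the set of strings $(a_1,\dots,a_n)$ for which there is a nonzero vector $e$ in some $C$-representation with $J_ie=a_ie$ for all $i$. Let $\mathrm{Cont}_m(n)$ be the set of content strings, that is, of strings $(a_1,\dots,a_n)$ whose entries are all of the form $v_kq^{2z}$ with $1\le k\le m$, $z\in\mathbb{Z}$, $|z|<n$, and such that, where $k$ and $z$ always run over $1\le k\le m$ and the integers $|z|<n$: - (c1) $a_1\in\{v_1,\dots,v_m\}$; - (c2) for all $j>1$: if $a_j=v_kq^{2z}$ for some $k$ and some $z\neq 0$, then $\{v_kq^{2(z-1)},v_kq^{2(z+1)}\}\cap\{a_1,\dots,a_{j-1}\}\neq\varnothing$; - (c3) if $a_i=a_j=v_kq^{2z}$ with $i<j$ for some $k$ and $z$, then $\{v_kq^{2(z-1)},v_kq^{2(z+1)}\}\subset\{a_{i+1},\dots,a_{j-1}\}$. A standard $m$-tableau of size $n$ is an $m$-tuple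 of Young diagrams with $n$ nodes in total, filled bijectively with $1,\dots,n$ so that in every diagram the numbers increase along rows and down columns. Its string of contents is $(c_1,\dots,c_n)$, where $c_i=v_kq^{2(s-r)}$ if the number $i$ stands in row $r$ and column $s$ of the $k$-th diagram. Then the set $\mathrm{Spec}(J_1,\dots,J_n)$, the set $\mathrm{Cont}_m(n)$ and the set of standard $m$-tableaux of size $n$ are in pairwise bijection. More precisely, $\mathrm{Spec}(J_1,\dots,J_n)=\mathrm{Cont}_m(n)$, and the map sending a tableau to its string of contents is a bijection from the set of standard $m$-tableaux of size $n$ onto this set. -/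

import Mathlib

universe u

namespace CyclotomicHecke

/-- The generators `τ, σ₁, …, σₙ₋₁` (for `n ≥ 1`); `sigma i` stands for `σ_{i+1}`. -/
inductive Gen (n : ℕ) : Type
  | tau : Gen n
  | sigma (i : Fin (n - 1)) : Gen n

section Algebra

variable {K : Type u} [Field K]

/-- The generator `τ` of the free algebra. -/
def freeTau (K : Type u) [Field K] (n : ℕ) : FreeAlgebra K (Gen n) :=
  FreeAlgebra.ι K Gen.tau

/-- The generator `σ_{i+1}` of the free algebra. -/
def freeSigma (K : Type u) [Field K] {n : ℕ} (i : Fin (n - 1)) : FreeAlgebra K (Gen n) :=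
  FreeAlgebra.ι K (Gen.sigma i)

/-- The defining relations of the cyclotomic Hecke algebra `H(m,1,n)` with parameters
`q` and `v₁, …, vₘ`. For nonzero `q` and `vⱼ` the relations `quadratic` and `cyclotomic` make all
generators invertible, so the quotient of the free algebra by these relations is also the
quotient of the group algebra of the braid group of type B. -/
inductive Rel {m : ℕ} (n : ℕ) (q : K) (v : Fin m → K) :
    FreeAlgebra K (Gen n) → FreeAlgebra K (Gen n) → Prop
  | braid (i j : Fin (n - 1)) (h : (i : ℕ) + 1 = j) :
      Rel n q v (freeSigma K i * freeSigma K j * freeSigma K i)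
        (freeSigma K j * freeSigma K i * freeSigma K j)
  | far_comm (i j : Fin (n - 1)) (h : (i : ℕ) + 1 < j) :
      Rel n q v (freeSigma K i * freeSigma K j) (freeSigma K j * freeSigma K i)
  | tau_braid (i : Fin (n - 1)) (h : (i : ℕ) = 0) :
      Rel n q v (freeTau K n * freeSigma K i * freeTau K n * freeSigma K i)
        (freeSigma K i * freeTau K n * freeSigma K i * freeTau K n)
  | tau_comm (i : Fin (n - 1)) (h : 0 < (i : ℕ)) :
      Rel n q v (freeTau K n * freeSigma K i) (freeSigma K i * freeTau K n)
  | quadratic (i : Fin (n - 1)) :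
      Rel n q v (freeSigma K i ^ 2) ((q - q⁻¹) • freeSigma K i + 1)
  | cyclotomic :
      Rel n q v
        (List.ofFn fun k => freeTau K n - algebraMap K (FreeAlgebra K (Gen n)) (v k)).prod 0

/-- The cyclotomic Hecke algebra `H(m,1,n)` over `K` with parameters `q` and `v₁, …, vₘ`. -/
abbrev HeckeAlgebra {m : ℕ} (n : ℕ) (q : K) (v : Fin m → K) : Type u :=
  RingQuot (Rel n q v)

variable {m n : ℕ} (q : K) (v : Fin m → K)

/-- The element `τ` of `H(m,1,n)`. -/
def tau : HeckeAlgebra n q v :=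
  RingQuot.mkAlgHom K (Rel n q v) (freeTau K n)

/-- The element `σ_{i+1}` of `H(m,1,n)`. -/
def sigma (i : Fin (n - 1)) : HeckeAlgebra n q v :=
  RingQuot.mkAlgHom K (Rel n q v) (freeSigma K i)

/-- The Jucys–Murphy elements; `jucysMurphy q v i hi` is `J_{i+1}`:
`J₁ = τ` and `J_{i+2} = σ_{i+1} J_{i+1} σ_{i+1}`. -/
def jucysMurphy : (i : ℕ) → i < n → HeckeAlgebra n q v
  | 0, _ => tau q v
  | i + 1, h =>
      sigma q v ⟨i, by omega⟩ * jucysMurphy i (by omega) * sigma q v ⟨i, by omega⟩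

variable {q v}

/-- `C`-representations: all Jucys–Murphy elements act by diagonalizable operators, and for every
`i` the action of the subalgebra generated by `J_i`, `J_{i+1}` and `σ_i` is completely
reducible. -/
structure IsCRepresentation {V : Type u} [AddCommGroup V] [Module K V]
    (ρ : HeckeAlgebra n q v →ₐ[K] Module.End K V) : Prop where
  diagonalizable : ∀ (i : ℕ) (hi : i < n),
    ⨆ μ : K, Module.End.eigenspace (ρ (jucysMurphy q v i hi)) μ = ⊤
  completely_reducible : ∀ (i : ℕ) (hi : i + 1 < n),
    IsSemisimpleModule
      (Algebra.adjoin K ({ρ (jucysMurphy q v i (by omega)), ρ (jucysMurphy q v (i + 1) hi),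
        ρ (sigma q v ⟨i, by omega⟩)} : Set (Module.End K V))) V

variable (n q v)

/-- `Spec(J₁, …, Jₙ)`: the strings of joint eigenvalues of the Jucys–Murphy elements in
(finite-dimensional) `C`-representations of `H(m,1,n)`. -/
def jmSpec : Set (Fin n → K) :=
  {a | ∃ (V : Type u) (_ : AddCommGroup V) (_ : Module K V) (_ : FiniteDimensional K V)
      (ρ : HeckeAlgebra n q v →ₐ[K] Module.End K V),
      IsCRepresentation ρ ∧
        ∃ e : V, e ≠ 0 ∧ ∀ i : Fin n, ρ (jucysMurphy q v i i.isLt) e = a i • e}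

/-- Content strings of length `n`. The entries are numbers of the form `v_k q^{2z}` with `|z| < n`,
which is the range of the contents of the nodes of `m`-diagrams with `n` nodes; the exponents in
the conditions `c2` and `c3` run over the same range. -/
structure IsContentString (a : Fin n → K) : Prop where
  entries : ∀ j, ∃ (k : Fin m) (z : ℤ), |z| < n ∧ a j = v k * q ^ (2 * z)
  c1 : ∀ j : Fin n, (j : ℕ) = 0 → a j ∈ Set.range v
  c2 : ∀ j : Fin n, 0 < (j : ℕ) → ∀ (k : Fin m) (z : ℤ), |z| < n → z ≠ 0 →
    a j = v k * q ^ (2 * z) →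
      (({v k * q ^ (2 * (z - 1)), v k * q ^ (2 * (z + 1))} : Set K) ∩ a '' Set.Iio j).Nonempty
  c3 : ∀ i j : Fin n, i < j → ∀ (k : Fin m) (z : ℤ), |z| < n →
    a i = v k * q ^ (2 * z) → a j = v k * q ^ (2 * z) →
      ({v k * q ^ (2 * (z - 1)), v k * q ^ (2 * (z + 1))} : Set K) ⊆ a '' Set.Ioo i j

/-- `Cont_m(n)`, the set of content strings of length `n`. -/
def contentStrings : Set (Fin n → K) :=
  {a | IsContentString n q v a}

end Algebra

/-- Standard Young `m`-tableaux with `n` nodes: an `m`-tuple of Young diagrams whose nodes are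
numbered bijectively, increasingly along rows and down columns. `node i` is the node carrying the
number `i + 1`, given as (index of the diagram, row, column), all counted from `0`. -/
structure StandardTableau (m n : ℕ) where
  shape : Fin m → YoungDiagram
  node : Fin n → Fin m × ℕ × ℕ
  node_injective : Function.Injective node
  range_node : Set.range node = {x | x.2 ∈ shape x.1}
  row_lt : ∀ i j, (node i).1 = (node j).1 → (node i).2.1 = (node j).2.1 →
    (node i).2.2 < (node j).2.2 → i < j
  col_lt : ∀ i j, (node i).1 = (node j).1 → (node i).2.2 = (node j).2.2 →
    (node i).2.1 < (node j).2.1 → i < j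

/-- The string of contents of a standard `m`-tableau: the node in row `r` and column `s` of the
`k`-th diagram has content `v_k q^{2(s-r)}`. -/
def StandardTableau.contentString {K : Type u} [Field K] {m n : ℕ} (q : K) (v : Fin m → K)
    (T : StandardTableau m n) : Fin n → K :=
  fun i => v (T.node i).1 * q ^ (2 * (((T.node i).2.2 : ℤ) - ((T.node i).2.1 : ℤ)))

end CyclotomicHecke

/-! All three sets are compared with the strings satisfying `IsLocalContent`, a form of (c1)–(c3)
that speaks only of ratios `q ^ 2` between entries (`isContentString_iff`).

Tableaux. Genericity makes the content of a node determine its diagram and its diagonal, as long as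
only nodes present or addable are compared (`same_diagonal`). Hence each new entry of a content
string dictates exactly one addable node (`exists_new_node`, `eq_of_nodeContent_eq`), and strings
correspond to tableaux.

Spectrum inside contents. Let `e` be a joint eigenvector with eigenvalues `a`. Neighbouring
eigenvalues differ, since otherwise `J_i` would have a Jordan block (`weights_ne`). If their ratio
is not `q ^ 2` or its inverse, a combination of `σ_i e` and `e` is a joint eigenvector for the
transposed string (`swap_mem_weights`). If it is, complete reducibility makes `e` an eigenvector of
`σ_i` (`sigma_apply_of_eq_sq_mul`), and the braid relation then forbids segments `x, y, x` with such
a ratio. These facts imply the content conditions by pure combinatorics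
(`isLocalContent_of_swap_mem`).

Contents inside spectrum. Young's seminormal formulas define a representation on the functions
supported on content strings. There `J_i` multiplies by the `i`-th entry, so the delta function at a
content string is a joint eigenvector with that string (`seminormal_jucysMurphy`), and the space is
a `C`-representation (`isCRepresentation_seminormal`). -/

namespace CyclotomicHecke

/-! ### Genericity and the local form of content strings -/

section Strings

variable {K : Type u} [Field K] {m n : ℕ} {q : K} {v : Fin m → K}

/-- The parameters of the algebra are generic for strings of length `n`: the powers of `q ^ 2`
and the `v k` do not interfere in the range of contents of `m`-diagrams with `n` nodes. -/
structure IsGeneric (n : ℕ) (q : K) (v : Fin m → K) : Prop where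
  q_ne_zero : q ≠ 0
  zpow_ne_one : ∀ d : ℤ, d ≠ 0 → |d| ≤ n → q ^ (2 * d) ≠ 1
  separated : ∀ d : ℤ, |d| < n → ∀ j k : Fin m, j ≠ k → q ^ (2 * d) * v j ≠ v k
  v_ne_zero : ∀ k, v k ≠ 0
  sq_ne_one : q ^ 2 ≠ 1

/-- The geometric sum with `d` terms times `q ^ 2 - 1` is `q ^ (2 * d) - 1`; negative exponents
follow by inversion. -/
theorem IsGeneric.of_sum_ne_zero (hq0 : q ≠ 0) (hq1 : q ^ 2 ≠ 1)
    (h1 : ∀ N : ℕ, N < n → ∑ i ∈ Finset.range (N + 1), q ^ (2 * i) ≠ 0)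
    (h2 : ∀ i : ℤ, -(n : ℤ) < i → i < (n : ℤ) → ∀ j k : Fin m, j ≠ k →
      q ^ (2 * i) * v j - v k ≠ 0)
    (h3 : ∀ j : Fin m, v j ≠ 0) : IsGeneric n q v where
  q_ne_zero := hq0
  sq_ne_one := hq1
  v_ne_zero := h3
  separated d hd j k hjk h := h2 d (abs_lt.1 hd).1 (abs_lt.1 hd).2 j k hjk (sub_eq_zero.2 h)
  zpow_ne_one := by
    have key : ∀ d : ℕ, 0 < d → d ≤ n → q ^ (2 * d) ≠ 1 := by
      intro d hd hdn h
      obtain ⟨N, rfl⟩ : ∃ N, d = N + 1 := ⟨d - 1, by omega⟩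
      refine h1 N (by omega) ?_
      have := geom_sum_mul (q ^ 2) (N + 1)
      simp only [← pow_mul] at this
      rw [h, sub_self] at this
      exact (mul_eq_zero.1 this).resolve_right (sub_ne_zero.2 hq1)
    intro d hd hdn h
    obtain ⟨e, rfl | rfl⟩ := Int.eq_nat_or_neg d
    · refine key e (by omega) (by simpa using hdn) ?_
      exact_mod_cast h
    · refine key e (by omega) (by simpa using hdn) ?_
      rw [mul_neg, zpow_neg, inv_eq_one] at h
      exact_mod_cast h

/-- Contents of the same value attached to close enough diagonals belong to the same diagonal. -/
theorem IsGeneric.eq_of_content_eq (h : IsGeneric n q v) {k k' : Fin m} {z z' : ℤ}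
    (hk : k = k' → |z - z'| ≤ n) (hk' : k ≠ k' → |z - z'| < n)
    (e : v k * q ^ (2 * z) = v k' * q ^ (2 * z')) : k = k' ∧ z = z' := by
  have e' : q ^ (2 * (z - z')) * v k = v k' := by
    rw [mul_sub, zpow_sub₀ h.q_ne_zero, div_mul_eq_mul_div, div_eq_iff (zpow_ne_zero _ h.q_ne_zero),
      ← e, mul_comm]
  by_cases hkk : k = k'
  · subst hkk
    refine ⟨rfl, ?_⟩
    by_contra hz
    exact h.zpow_ne_one (z - z') (sub_ne_zero.2 hz) (hk rfl) (mul_right_cancel₀ (h.v_ne_zero k)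
      (e'.trans (one_mul _).symm))
  · exact absurd e' (h.separated _ (hk' hkk) k k' hkk)

theorem IsGeneric.one_add_sq_ne_zero (h : IsGeneric n q v) (hn : 2 ≤ n) : 1 + q ^ 2 ≠ 0 := by
  intro h0
  refine h.zpow_ne_one 2 (by norm_num) (by simpa using hn) ?_
  have : q ^ 2 = -1 := by linear_combination h0
  calc q ^ (2 * 2 : ℤ) = (q ^ 2) ^ 2 := by norm_cast; ring
    _ = 1 := by rw [this]; ring

theorem sub_inv_ne_zero_of_sq_ne_one (hq0 : q ≠ 0) (hq1 : q ^ 2 ≠ 1) : q - q⁻¹ ≠ 0 := by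
  intro h
  apply hq1
  field_simp at h
  linear_combination h

/-- Content strings, described without reference to the form of the entries. -/
structure IsLocalContent (q : K) (v : Fin m → K) (a : Fin n → K) : Prop where
  start : ∀ j, a j ∈ Set.range v ∨ ∃ i < j, a j = q ^ 2 * a i ∨ a i = q ^ 2 * a j
  gap : ∀ i j, i < j → a i = a j →
    (∃ k, i < k ∧ k < j ∧ a k = q ^ 2 * a i) ∧ ∃ k, i < k ∧ k < j ∧ a i = q ^ 2 * a k

/-- Each link to an earlier entry changes the exponent by one, so with positions counted from `0`
the exponent is at most `j` in absolute value, hence below `n`. -/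
theorem IsLocalContent.exists_entry (hq : q ≠ 0) {a : Fin n → K} (ha : IsLocalContent q v a)
    (j : Fin n) : ∃ (k : Fin m) (z : ℤ), |z| ≤ (j : ℕ) ∧ a j = v k * q ^ (2 * z) := by
  induction j using WellFoundedLT.induction with | ind j ih
  rcases ha.start j with ⟨k, hk⟩ | ⟨i, hij, h⟩
  · exact ⟨k, 0, by simp, by simp [hk]⟩
  · obtain ⟨k, z, hz, e⟩ := ih i hij
    have hij' : (i : ℕ) < j := hij
    rw [abs_le] at hz
    rcases h with h | h
    · refine ⟨k, z + 1, by rw [abs_le]; constructor <;> linarith, ?_⟩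
      rw [h, e, mul_add, zpow_add₀ hq]
      norm_cast
      ring
    · refine ⟨k, z - 1, by rw [abs_le]; constructor <;> linarith, ?_⟩
      have h2 : q ^ (2 : ℤ) ≠ 0 := zpow_ne_zero _ hq
      rw [mul_sub, zpow_sub₀ hq, mul_one]
      rw [e] at h
      field_simp
      rw [h]
      ring

theorem IsLocalContent.ne_zero (hq : q ≠ 0) (hv : ∀ k, v k ≠ 0) {a : Fin n → K}
    (ha : IsLocalContent q v a) (j : Fin n) : a j ≠ 0 := by
  obtain ⟨k, z, -, e⟩ := ha.exists_entry hq j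
  rw [e]
  exact mul_ne_zero (hv k) (zpow_ne_zero _ hq)

theorem content_succ (hq : q ≠ 0) (x : K) (z : ℤ) :
    x * q ^ (2 * (z + 1)) = q ^ 2 * (x * q ^ (2 * z)) := by
  rw [mul_add, zpow_add₀ hq]
  norm_cast
  ring

theorem content_pred (hq : q ≠ 0) (x : K) (z : ℤ) :
    q ^ 2 * (x * q ^ (2 * (z - 1))) = x * q ^ (2 * z) := by
  rw [← content_succ hq, sub_add_cancel]

theorem eq_content_pred_iff (hq : q ≠ 0) (x y : K) (z : ℤ) :
    y = x * q ^ (2 * (z - 1)) ↔ x * q ^ (2 * z) = q ^ 2 * y := by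
  rw [← content_pred hq x z]
  constructor
  · rintro rfl; rfl
  · intro h
    exact (mul_left_cancel₀ (pow_ne_zero 2 hq) h).symm

/-- The form of the entries comes for free from `exists_entry`. The one place where genericity
enters is (c2): an entry in the range of `v` cannot also be `v k * q ^ (2 * z)` with `0 < |z| < n`.
-/
theorem isContentString_iff (h : IsGeneric n q v) (a : Fin n → K) :
    IsContentString n q v a ↔ IsLocalContent q v a := by
  have hq := h.q_ne_zero
  constructor
  · intro ha
    refine ⟨fun j => ?_, fun i j hij e => ?_⟩
    · obtain ⟨k, z, hz, e⟩ := ha.entries j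
      by_cases hz0 : z = 0
      · exact Or.inl ⟨k, by simp [e, hz0]⟩
      · rcases Nat.eq_zero_or_pos (j : ℕ) with hj | hj
        · exact Or.inl (ha.c1 j hj)
        obtain ⟨_, h1 | h1, i, hi, rfl⟩ := ha.c2 j hj k z hz hz0 e
        · refine Or.inr ⟨i, hi, Or.inl ?_⟩
          rw [e]
          exact (eq_content_pred_iff hq _ _ _).1 h1
        · refine Or.inr ⟨i, hi, Or.inr ?_⟩
          rw [e, ← content_succ hq]
          exact h1
    · obtain ⟨k, z, hz, ei⟩ := ha.entries i
      have := ha.c3 i j hij k z hz ei (e ▸ ei)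
      obtain ⟨p, hp, ep⟩ := this (Set.mem_insert _ _)
      obtain ⟨r, hr, er⟩ := this (Set.mem_insert_of_mem _ rfl)
      refine ⟨⟨r, hr.1, hr.2, ?_⟩, ⟨p, hp.1, hp.2, ?_⟩⟩
      · rw [er, content_succ hq, ei]
      · rw [ei]; exact (eq_content_pred_iff hq _ _ _).1 ep
  · intro ha
    refine ⟨fun j => ?_, fun j hj => ?_, fun j _ k z hz hz0 e => ?_, fun i j hij k z hz ei ej => ?_⟩
    · obtain ⟨k, z, hz, e⟩ := ha.exists_entry hq j
      exact ⟨k, z, hz.trans_lt (by exact_mod_cast j.2), e⟩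
    · rcases ha.start j with h' | ⟨i, hi, -⟩
      · exact h'
      · have : (i : ℕ) < j := hi
        omega
    · rcases ha.start j with ⟨k', h'⟩ | ⟨i, hi, h' | h'⟩
      · refine absurd ?_ hz0
        refine (h.eq_of_content_eq (z := z) (z' := 0) (k := k) (k' := k') ?_ ?_ ?_).2
        · intro _; simpa using hz.le
        · intro _; simpa using hz
        · rw [← e, ← h']; simp
      · refine ⟨a i, Or.inl ?_, i, hi, rfl⟩
        rw [eq_content_pred_iff hq, ← e, h']
      · refine ⟨a i, Or.inr ?_, i, hi, rfl⟩
        change _ = _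
        rw [content_succ hq, ← e, h']
    · obtain ⟨⟨r, hr, hr', er⟩, p, hp, hp', ep⟩ := ha.gap i j hij (ei.trans ej.symm)
      rintro x (rfl | rfl)
      · refine ⟨p, ⟨hp, hp'⟩, ?_⟩
        rw [eq_content_pred_iff hq, ← ei, ep]
      · refine ⟨r, ⟨hr, hr'⟩, ?_⟩
        rw [content_succ hq, ← ei, er]

end Strings

/-! ### Standard tableaux and their contents -/

section Tableaux

variable {K : Type u} [Field K] {m n : ℕ} {q : K} {v : Fin m → K}

/-- The content of the node in row `x.2.1` and column `x.2.2` of the `x.1`-th diagram. -/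
def nodeContent (q : K) (v : Fin m → K) (x : Fin m × ℕ × ℕ) : K :=
  v x.1 * q ^ (2 * ((x.2.2 : ℤ) - (x.2.1 : ℤ)))

/-- The first `l` nodes of a standard tableau, given as a numbering of nodes: they are distinct,
and the left and upper neighbours of each node come earlier. -/
structure IsStandardUpTo (l : ℕ) (node : Fin n → Fin m × ℕ × ℕ) : Prop where
  injOn : ∀ i j : Fin n, (i : ℕ) < l → (j : ℕ) < l → node i = node j → i = j
  up : ∀ j : Fin n, (j : ℕ) < l → ∀ k r s, node j = (k, r + 1, s) → ∃ i < j, node i = (k, r, s)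
  left : ∀ j : Fin n, (j : ℕ) < l → ∀ k r s, node j = (k, r, s + 1) → ∃ i < j, node i = (k, r, s)

namespace IsStandardUpTo

variable {l : ℕ} {node : Fin n → Fin m × ℕ × ℕ}

theorem mono (h : IsStandardUpTo l node) {l' : ℕ} (hl : l' ≤ l) : IsStandardUpTo l' node where
  injOn i j hi hj := h.injOn i j (hi.trans_le hl) (hj.trans_le hl)
  up j hj := h.up j (hj.trans_le hl)
  left j hj := h.left j (hj.trans_le hl)

theorem exists_up (h : IsStandardUpTo l node) {j : Fin n} (hj : (j : ℕ) < l) {k : Fin m}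
    {d r s : ℕ} (e : node j = (k, r + d, s)) : ∃ i ≤ j, node i = (k, r, s) := by
  induction d generalizing j with
  | zero => exact ⟨j, le_rfl, e⟩
  | succ d ih =>
    obtain ⟨i, hi, ei⟩ := h.up j hj k (r + d) s e
    obtain ⟨p, hp, ep⟩ := ih (lt_trans hi hj) ei
    exact ⟨p, hp.trans hi.le, ep⟩

theorem exists_left (h : IsStandardUpTo l node) {j : Fin n} (hj : (j : ℕ) < l) {k : Fin m}
    {d r s : ℕ} (e : node j = (k, r, s + d)) : ∃ i ≤ j, node i = (k, r, s) := by
  induction d generalizing j with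
  | zero => exact ⟨j, le_rfl, e⟩
  | succ d ih =>
    obtain ⟨i, hi, ei⟩ := h.left j hj k r (s + d) e
    obtain ⟨p, hp, ep⟩ := ih (lt_trans hi hj) ei
    exact ⟨p, hp.trans hi.le, ep⟩

theorem exists_le (h : IsStandardUpTo l node) {j : Fin n} (hj : (j : ℕ) < l) {k : Fin m}
    {r s r' s' : ℕ} (e : node j = (k, r', s')) (hr : r ≤ r') (hs : s ≤ s') :
    ∃ i ≤ j, node i = (k, r, s) := by
  obtain ⟨d, rfl⟩ := Nat.exists_eq_add_of_le hr
  obtain ⟨d', rfl⟩ := Nat.exists_eq_add_of_le hs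
  obtain ⟨i, hi, ei⟩ := h.exists_up hj e
  obtain ⟨p, hp, ep⟩ := h.exists_left (lt_of_le_of_lt hi hj) ei
  exact ⟨p, hp.trans hi, ep⟩

theorem le_of_le (h : IsStandardUpTo l node) {i j : Fin n} (hi : (i : ℕ) < l) (hj : (j : ℕ) < l)
    {k : Fin m} {r s r' s' : ℕ} (ei : node i = (k, r, s)) (ej : node j = (k, r', s'))
    (hr : r ≤ r') (hs : s ≤ s') : i ≤ j := by
  obtain ⟨p, hp, ep⟩ := h.exists_le hj ej hr hs
  rwa [h.injOn i p hi (lt_of_le_of_lt hp hj) (ei.trans ep.symm)]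

/-- Counting the nodes of a row and of a column. -/
theorem row_add_col_le {k k' : Fin m} {R S : ℕ}
    (hS : ∀ t < S, ∃ i : Fin n, (i : ℕ) < l ∧ node i = (k, 0, t))
    (hR : ∀ t < R, ∃ i : Fin n, (i : ℕ) < l ∧ node i = (k', t, 0)) :
    (k = k' → S + R ≤ l + 1) ∧ (k ≠ k' → S + R ≤ l) := by
  classical
  let P : Finset (Fin m × ℕ × ℕ) := (Finset.univ.filter fun i : Fin n => (i : ℕ) < l).image node
  have hP : P.card ≤ l := by
    refine Finset.card_image_le.trans ?_
    rw [← Finset.card_map Fin.valEmbedding]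
    refine (Finset.card_le_card (t := Finset.range l) ?_).trans (Finset.card_range l).le
    intro x hx
    simp only [Finset.mem_map, Finset.mem_filter, Finset.mem_univ, true_and] at hx
    obtain ⟨i, hi, rfl⟩ := hx
    simpa using hi
  let A : Finset (Fin m × ℕ × ℕ) := (Finset.range S).image fun t => (k, 0, t)
  have hAc : A.card = S := by
    rw [Finset.card_image_of_injective _ (fun t t' h => by simpa using h), Finset.card_range]
  have hA : A ⊆ P := by
    intro x hx
    obtain ⟨t, ht, rfl⟩ := Finset.mem_image.1 hx
    obtain ⟨i, hi, e⟩ := hS t (Finset.mem_range.1 ht)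
    exact Finset.mem_image.2 ⟨i, by simpa using hi, e⟩
  let B : Finset (Fin m × ℕ × ℕ) := (Finset.range R).image fun t => (k', t, 0)
  have hBc : B.card = R := by
    rw [Finset.card_image_of_injective _ (fun t t' h => by simpa using h), Finset.card_range]
  have hB : B ⊆ P := by
    intro x hx
    obtain ⟨t, ht, rfl⟩ := Finset.mem_image.1 hx
    obtain ⟨i, hi, e⟩ := hR t (Finset.mem_range.1 ht)
    exact Finset.mem_image.2 ⟨i, by simpa using hi, e⟩
  have hAB := Finset.card_union_add_card_inter A B
  have hU := (Finset.card_le_card (Finset.union_subset hA hB)).trans hP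
  have mem_inter : ∀ x ∈ A ∩ B, k = k' ∧ x = (k, 0, 0) := by
    intro x hx
    obtain ⟨h1, h2⟩ := Finset.mem_inter.1 hx
    obtain ⟨t, -, rfl⟩ := Finset.mem_image.1 h1
    obtain ⟨t', -, e⟩ := Finset.mem_image.1 h2
    simp only [Prod.mk.injEq] at e ⊢
    exact ⟨e.1.symm, trivial, trivial, e.2.2.symm⟩
  constructor
  · intro _
    have : (A ∩ B).card ≤ 1 := Finset.card_le_one.2 fun x hx y hy =>
      (mem_inter x hx).2.trans (mem_inter y hy).2.symm
    omega
  · intro hk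
    have : (A ∩ B) = ∅ := Finset.eq_empty_of_forall_notMem fun x hx => hk (mem_inter x hx).1
    rw [this, Finset.card_empty] at hAB
    omega

/-- Nodes present in the first row and column force the nodes before them. -/
theorem row_of_lt (h : IsStandardUpTo l node) {k : Fin m} {s : ℕ}
    (hs : 0 < s → ∃ i : Fin n, (i : ℕ) < l ∧ ∃ r, node i = (k, r, s - 1)) :
    ∀ t < s, ∃ i : Fin n, (i : ℕ) < l ∧ node i = (k, 0, t) := by
  intro t ht
  obtain ⟨i, hi, r, e⟩ := hs (by omega)
  obtain ⟨p, hp, ep⟩ := h.exists_le hi e (Nat.zero_le r) (Nat.le_sub_one_of_lt ht)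
  exact ⟨p, lt_of_le_of_lt hp hi, ep⟩

theorem col_of_lt (h : IsStandardUpTo l node) {k : Fin m} {r : ℕ}
    (hr : 0 < r → ∃ i : Fin n, (i : ℕ) < l ∧ ∃ s, node i = (k, r - 1, s)) :
    ∀ t < r, ∃ i : Fin n, (i : ℕ) < l ∧ node i = (k, t, 0) := by
  intro t ht
  obtain ⟨i, hi, s, e⟩ := hr (by omega)
  obtain ⟨p, hp, ep⟩ := h.exists_le hi e (Nat.le_sub_one_of_lt ht) (Nat.zero_le s)
  exact ⟨p, lt_of_le_of_lt hp hi, ep⟩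

/-- The nodes of a diagram, as well as those that can be added to it, are determined up to the
diagonal by their contents. -/
theorem same_diagonal (hg : IsGeneric n q v) (h : IsStandardUpTo l node) (hl : l < n)
    {x y : Fin m × ℕ × ℕ}
    (hxs : 0 < x.2.2 → ∃ i : Fin n, (i : ℕ) < l ∧ ∃ r, node i = (x.1, r, x.2.2 - 1))
    (hxr : 0 < x.2.1 → ∃ i : Fin n, (i : ℕ) < l ∧ ∃ s, node i = (x.1, x.2.1 - 1, s))
    (hys : 0 < y.2.2 → ∃ i : Fin n, (i : ℕ) < l ∧ ∃ r, node i = (y.1, r, y.2.2 - 1))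
    (hyr : 0 < y.2.1 → ∃ i : Fin n, (i : ℕ) < l ∧ ∃ s, node i = (y.1, y.2.1 - 1, s))
    (e : nodeContent q v x = nodeContent q v y) :
    x.1 = y.1 ∧ x.2.2 + y.2.1 = y.2.2 + x.2.1 := by
  -- The exponents differ by `(s + r') - (s' + r)`, where `x` is in row `r` and column `s`, and `y`
  -- in row `r'` and column `s'`. Both sums count nodes of a first row and a first column, which
  -- share at most a corner, and only if the diagrams coincide: this gives `l + 1 ≤ n` or `l < n`,
  -- exactly the ranges where genericity applies.
  obtain ⟨h1, h2⟩ := row_add_col_le (h.row_of_lt hxs) (h.col_of_lt hyr)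
  obtain ⟨h3, h4⟩ := row_add_col_le (h.row_of_lt hys) (h.col_of_lt hxr)
  obtain ⟨ek, ez⟩ := hg.eq_of_content_eq (fun hk => by
    have := h1 hk; have := h3 hk.symm; rw [abs_le]; omega) (fun hk => by
    have := h2 hk; have := h4 (Ne.symm hk); rw [abs_lt]; omega) e
  exact ⟨ek, by omega⟩

theorem up_lt (h : IsStandardUpTo l node) {l' : ℕ} {j : Fin n} (hj : (j : ℕ) < l)
    (hj' : (j : ℕ) ≤ l') (hr : 0 < (node j).2.1) :
    ∃ i : Fin n, (i : ℕ) < l' ∧ ∃ s, node i = ((node j).1, (node j).2.1 - 1, s) := by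
  obtain ⟨i, hi, e⟩ := h.up j hj (node j).1 ((node j).2.1 - 1) (node j).2.2
    (by rw [Nat.sub_add_cancel hr])
  exact ⟨i, lt_of_lt_of_le hi hj', _, e⟩

theorem left_lt (h : IsStandardUpTo l node) {l' : ℕ} {j : Fin n} (hj : (j : ℕ) < l)
    (hj' : (j : ℕ) ≤ l') (hs : 0 < (node j).2.2) :
    ∃ i : Fin n, (i : ℕ) < l' ∧ ∃ r, node i = ((node j).1, r, (node j).2.2 - 1) := by
  obtain ⟨i, hi, e⟩ := h.left j hj (node j).1 (node j).2.1 ((node j).2.2 - 1)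
    (by rw [Nat.sub_add_cancel hs])
  exact ⟨i, lt_of_lt_of_le hi hj', _, e⟩

end IsStandardUpTo

theorem nodeContent_right (hq : q ≠ 0) (k : Fin m) (r s : ℕ) :
    nodeContent q v (k, r, s + 1) = q ^ 2 * nodeContent q v (k, r, s) := by
  rw [nodeContent, nodeContent, ← content_succ hq]
  congr 3
  push_cast
  ring

theorem nodeContent_down (hq : q ≠ 0) (k : Fin m) (r s : ℕ) :
    nodeContent q v (k, r, s) = q ^ 2 * nodeContent q v (k, r + 1, s) := by
  rw [nodeContent, nodeContent, ← content_succ hq]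
  congr 3
  push_cast
  ring

theorem nodeContent_diag (k : Fin m) (r s : ℕ) :
    nodeContent q v (k, r + 1, s + 1) = nodeContent q v (k, r, s) := by
  simp [nodeContent]

namespace IsStandardUpTo

variable {node : Fin n → Fin m × ℕ × ℕ}

/-- A left or upper neighbour supplies the link for `start`. For `gap`, equal contents put both
nodes on one diagonal, the later one strictly further down; the right and lower neighbours of the
earlier node are then weakly above and to the left of the later one, so they are numbered in
between. -/
theorem isLocalContent (hg : IsGeneric n q v) (h : IsStandardUpTo n node) :
    IsLocalContent q v fun i => nodeContent q v (node i) := by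
  have hq := hg.q_ne_zero
  refine ⟨fun j => ?_, fun i j hij e => ?_⟩
  · rcases hj : node j with ⟨k, r, s⟩
    rcases s with _ | s
    · rcases r with _ | r
      · exact Or.inl ⟨k, by simp [nodeContent]⟩
      · obtain ⟨i, hi, ei⟩ := h.up j j.2 k r 0 hj
        refine Or.inr ⟨i, hi, Or.inr ?_⟩
        simp only [ei]
        exact nodeContent_down hq _ _ _
    · obtain ⟨i, hi, ei⟩ := h.left j j.2 k r s hj
      refine Or.inr ⟨i, hi, Or.inl ?_⟩
      simp only [ei]
      exact nodeContent_right hq _ _ _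
  · have hij' : (i : ℕ) < j := hij
    -- Only the nodes numbered before `j` are taken as the diagram; the node of `j` is addable to
    -- it.
    have hd := (h.mono j.2.le).same_diagonal hg j.2 (x := node i) (y := node j)
      (h.left_lt i.2 hij'.le) (h.up_lt i.2 hij'.le) (h.left_lt j.2 le_rfl) (h.up_lt j.2 le_rfl) e
    rcases hi : node i with ⟨k, r, s⟩
    rcases hj : node j with ⟨k', r', s'⟩
    rw [hi, hj] at hd
    obtain ⟨hk, hd⟩ := hd
    simp only at hk hd
    subst hk
    have hrr : r < r' := by
      by_contra hr
      exact absurd (h.le_of_le j.2 i.2 hj hi (by omega) (by omega)) (not_le.2 hij)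
    constructor
    · obtain ⟨p, hp, ep⟩ := h.exists_le j.2 hj (r := r) (s := s + 1) (by omega) (by omega)
      have h1 : i ≤ p := h.le_of_le i.2 p.2 hi ep le_rfl (by omega)
      refine ⟨p, lt_of_le_of_ne h1 ?_, lt_of_le_of_ne hp ?_, ?_⟩
      · rintro rfl; simp [hi] at ep
      · rintro rfl; simp [hj] at ep; omega
      · simp only [ep]; exact nodeContent_right hq _ _ _
    · obtain ⟨p, hp, ep⟩ := h.exists_le j.2 hj (r := r + 1) (s := s) (by omega) (by omega)
      have h1 : i ≤ p := h.le_of_le i.2 p.2 hi ep (by omega) le_rfl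
      refine ⟨p, lt_of_le_of_ne h1 ?_, lt_of_le_of_ne hp ?_, ?_⟩
      · rintro rfl; simp [hi] at ep
      · rintro rfl; simp [hj] at ep; omega
      · simp only [ep]; exact nodeContent_down hq _ _ _

/-- A numbering of nodes is determined by the contents. -/
theorem eq_of_nodeContent_eq (hg : IsGeneric n q v) {node' : Fin n → Fin m × ℕ × ℕ}
    (h : IsStandardUpTo n node) (h' : IsStandardUpTo n node')
    (e : ∀ i, nodeContent q v (node i) = nodeContent q v (node' i)) : node = node' := by
  -- If `N' j` were further down the diagonal than `N j`, the node above `N' j` would already be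
  -- present before `j` in both numberings, and so would `N j`, which lies above and to the left of
  -- it.
  have aux : ∀ {N N' : Fin n → Fin m × ℕ × ℕ}, IsStandardUpTo n N → IsStandardUpTo n N' →
      ∀ j : Fin n, (∀ i < j, N i = N' i) → ∀ k r s r' s', N j = (k, r, s) → N' j = (k, r', s') →
      s + r' = s' + r → r' ≤ r := by
    intro N N' h h' j ih k r s r' s' hj hj' hd
    by_contra hr
    obtain ⟨r', rfl⟩ : ∃ t, r' = t + 1 := ⟨r' - 1, by omega⟩
    obtain ⟨i, hi, ei⟩ := h'.up j j.2 k r' s' hj'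
    rw [← ih i hi] at ei
    obtain ⟨p, hp, ep⟩ := h.exists_le i.2 ei (r := r) (s := s) (by omega) (by omega)
    exact absurd (h.injOn _ _ p.2 j.2 (ep.trans hj.symm)) (lt_of_le_of_lt hp hi).ne
  funext j
  induction j using WellFoundedLT.induction with | ind j ih
  have hs := h'.left_lt j.2 (le_refl (j : ℕ))
  have hr := h'.up_lt j.2 (le_refl (j : ℕ))
  have hd := (h.mono j.2.le).same_diagonal hg j.2 (x := node j) (y := node' j)
      (h.left_lt j.2 le_rfl) (h.up_lt j.2 le_rfl)
      (fun hp => (hs hp).imp fun i hi => ⟨hi.1, hi.2.imp fun _ e => (ih i hi.1).trans e⟩)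
      (fun hp => (hr hp).imp fun i hi => ⟨hi.1, hi.2.imp fun _ e => (ih i hi.1).trans e⟩) (e j)
  rcases hi : node j with ⟨k, r, s⟩
  rcases hj : node' j with ⟨k', r', s'⟩
  rw [hi, hj] at hd
  obtain ⟨hk, hd⟩ := hd
  simp only at hk hd
  subst hk
  have h1 := aux h h' j ih k r s r' s' hi hj hd
  have h2 := aux h' h j (fun i hi => (ih i hi).symm) k r' s' r s hj hi (by omega)
  simp only [Prod.mk.injEq, true_and]
  omega

/-- Adding a node. -/
theorem update {l : ℕ} (hl : l < n) (h : IsStandardUpTo l node) (k : Fin m) (r s : ℕ)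
    (hs : 0 < s → ∃ i : Fin n, (i : ℕ) < l ∧ node i = (k, r, s - 1))
    (hr : 0 < r → ∃ i : Fin n, (i : ℕ) < l ∧ node i = (k, r - 1, s))
    (hnew : ∀ i : Fin n, (i : ℕ) < l → node i ≠ (k, r, s)) :
    IsStandardUpTo (l + 1) (Function.update node ⟨l, hl⟩ (k, r, s)) := by
  have hlt : ∀ {i : Fin n} (x), (i : ℕ) < l → Function.update node ⟨l, hl⟩ x i = node i :=
    fun x hi => Function.update_of_ne (by rintro rfl; simp at hi) _ _
  have hcase : ∀ i : Fin n, (i : ℕ) < l + 1 → (i : ℕ) < l ∨ i = ⟨l, hl⟩ := by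
    intro i hi
    rcases Nat.lt_succ_iff_lt_or_eq.1 hi with h | h
    · exact Or.inl h
    · exact Or.inr (Fin.ext h)
  refine ⟨fun i j hi hj e => ?_, fun j hj k' r' s' e => ?_, fun j hj k' r' s' e => ?_⟩
  · rcases hcase i hi with hi | rfl <;> rcases hcase j hj with hj | rfl
    · rw [hlt _ hi, hlt _ hj] at e
      exact h.injOn i j hi hj e
    · rw [hlt _ hi, Function.update_self] at e
      exact absurd e (hnew i hi)
    · rw [hlt _ hj, Function.update_self] at e
      exact absurd e.symm (hnew j hj)
    · rfl
  · rcases hcase j hj with hj | rfl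
    · rw [hlt _ hj] at e
      obtain ⟨i, hi, ei⟩ := h.up j hj k' r' s' e
      exact ⟨i, hi, by rw [hlt _ (lt_trans hi hj), ei]⟩
    · rw [Function.update_self] at e
      simp only [Prod.mk.injEq] at e
      obtain ⟨rfl, rfl, rfl⟩ := e
      obtain ⟨i, hi, ei⟩ := hr (by omega)
      exact ⟨i, hi, by rw [hlt _ hi, ei, Nat.add_sub_cancel]⟩
  · rcases hcase j hj with hj | rfl
    · rw [hlt _ hj] at e
      obtain ⟨i, hi, ei⟩ := h.left j hj k' r' s' e
      exact ⟨i, hi, by rw [hlt _ (lt_trans hi hj), ei]⟩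
    · rw [Function.update_self] at e
      simp only [Prod.mk.injEq] at e
      obtain ⟨rfl, rfl, rfl⟩ := e
      obtain ⟨i, hi, ei⟩ := hs (by omega)
      exact ⟨i, hi, by rw [hlt _ hi, ei, Nat.add_sub_cancel]⟩

/-- The node to be added for the next entry of a content string. -/
theorem exists_new_node (hg : IsGeneric n q v) {a : Fin n → K} (ha : IsLocalContent q v a)
    {l : ℕ} (hl : l < n) (h : IsStandardUpTo l node)
    (hc : ∀ i : Fin n, (i : ℕ) < l → nodeContent q v (node i) = a i) :
    ∃ (k : Fin m) (r s : ℕ), nodeContent q v (k, r, s) = a ⟨l, hl⟩ ∧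
      (0 < s → ∃ i : Fin n, (i : ℕ) < l ∧ node i = (k, r, s - 1)) ∧
      (0 < r → ∃ i : Fin n, (i : ℕ) < l ∧ node i = (k, r - 1, s)) ∧
      ∀ i : Fin n, (i : ℕ) < l → node i ≠ (k, r, s) := by
  have hq := hg.q_ne_zero
  by_cases hx : ∃ i : Fin n, (i : ℕ) < l ∧ a i = a ⟨l, hl⟩
  -- The new node goes diagonally below the latest node `(k, r, s)` of the same content. The two
  -- entries provided by `gap` lie on the neighbouring diagonals after `(k, r, s)`, which forces
  -- `(k, r, s + 1)` and `(k, r + 1, s)` to be present.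
  · obtain ⟨i, ⟨hi, ei⟩, hmax⟩ : ∃ i : Fin n, ((i : ℕ) < l ∧ a i = a ⟨l, hl⟩) ∧
        ∀ j : Fin n, (j : ℕ) < l ∧ a j = a ⟨l, hl⟩ → j ≤ i := by
      classical
      obtain ⟨i, hi⟩ := (Finset.univ.filter fun i : Fin n =>
        (i : ℕ) < l ∧ a i = a ⟨l, hl⟩).exists_maximal
        (by simpa [Finset.filter_nonempty_iff] using hx)
      refine ⟨i, by simpa using hi.1, fun j hj => ?_⟩
      by_contra hij
      exact hij (hi.2 (by simpa using hj) (le_of_not_ge hij))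
    obtain ⟨⟨p, hip, hpl, ep⟩, p', hip', hpl', ep'⟩ := ha.gap i ⟨l, hl⟩ hi ei
    replace hpl : (p : ℕ) < l := hpl
    replace hpl' : (p' : ℕ) < l := hpl'
    rcases ni : node i with ⟨k, r, s⟩
    have hxi : a i = nodeContent q v (k, r, s) := by rw [← hc i hi, ni]
    have hcol : 0 < r → ∃ i : Fin n, (i : ℕ) < l ∧ ∃ s, node i = (k, r - 1, s) := by
      simpa only [ni] using h.up_lt hi hi.le
    have hrow : 0 < s → ∃ i : Fin n, (i : ℕ) < l ∧ ∃ r, node i = (k, r, s - 1) := by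
      simpa only [ni] using h.left_lt hi hi.le
    have right : ∃ i : Fin n, (i : ℕ) < l ∧ node i = (k, r, s + 1) := by
      have e : nodeContent q v (node p) = nodeContent q v (k, r, s + 1) := by
        rw [hc p hpl, ep, hxi, nodeContent_right hq]
      have hd := h.same_diagonal hg hl (h.left_lt hpl hpl.le) (h.up_lt hpl hpl.le)
        (fun _ => ⟨i, hi, r, ni⟩) hcol e
      rcases np : node p with ⟨k', r', s'⟩
      rw [np] at hd
      obtain ⟨rfl, hd⟩ := hd
      simp only at hd
      have hr : r ≤ r' := by
        by_contra hr
        exact absurd (h.le_of_le hpl hi np ni (by omega) (by omega)) (not_le.2 hip)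
      obtain ⟨t, ht, et⟩ := h.exists_le hpl np hr (s := s + 1) (by omega)
      exact ⟨t, lt_of_le_of_lt ht hpl, et⟩
    have down : ∃ i : Fin n, (i : ℕ) < l ∧ node i = (k, r + 1, s) := by
      have e : nodeContent q v (node p') = nodeContent q v (k, r + 1, s) := by
        refine mul_left_cancel₀ (pow_ne_zero 2 hq) ?_
        rw [hc p' hpl', ← ep', hxi, nodeContent_down hq]
      have hd := h.same_diagonal hg hl (h.left_lt hpl' hpl'.le) (h.up_lt hpl' hpl'.le)
        hrow (fun _ => ⟨i, hi, s, ni⟩) e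
      rcases np : node p' with ⟨k', r', s'⟩
      rw [np] at hd
      obtain ⟨rfl, hd⟩ := hd
      simp only at hd
      have hs : s ≤ s' := by
        by_contra hs
        exact absurd (h.le_of_le hpl' hi np ni (by omega) (by omega)) (not_le.2 hip')
      obtain ⟨t, ht, et⟩ := h.exists_le hpl' np (r := r + 1) (by omega) hs
      exact ⟨t, lt_of_le_of_lt ht hpl', et⟩
    refine ⟨k, r + 1, s + 1, ?_, fun _ => by simpa using down, fun _ => by simpa using right, ?_⟩
    · rw [nodeContent_diag, ← hxi, ei]
    · intro t ht et
      have h1 : t ≤ i := hmax t ⟨ht, by rw [← hc t ht, et, nodeContent_diag, ← hxi, ei]⟩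
      obtain rfl : t = i := le_antisymm h1 (h.le_of_le hi ht ni et (by omega) (by omega))
      simp [ni] at et
  -- When the content is new, its diagonal is empty, so the node must lie in the first row or first
  -- column: otherwise the upper or left neighbour of the linked node would already have this
  -- content.
  · push Not at hx
    have hnew : ∀ k r s, nodeContent q v (k, r, s) = a ⟨l, hl⟩ →
        ∀ i : Fin n, (i : ℕ) < l → node i ≠ (k, r, s) := by
      intro k r s e i hi ei
      exact hx i hi (by rw [← hc i hi, ei, e])
    rcases ha.start ⟨l, hl⟩ with ⟨k, hk⟩ | ⟨i, hi, e⟩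
    · have : nodeContent q v (k, 0, 0) = a ⟨l, hl⟩ := by simp [nodeContent, hk]
      exact ⟨k, 0, 0, this, by simp, by simp, hnew _ _ _ this⟩
    · replace hi : (i : ℕ) < l := hi
      rcases ni : node i with ⟨k, r, s⟩
      have hxi : a i = nodeContent q v (k, r, s) := by rw [← hc i hi, ni]
      rcases e with e | e
      · rcases r with _ | r
        · have : nodeContent q v (k, 0, s + 1) = a ⟨l, hl⟩ := by
            rw [nodeContent_right hq, ← hxi, e]
          exact ⟨k, 0, s + 1, this, fun _ => ⟨i, hi, ni⟩, by simp, hnew _ _ _ this⟩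
        · obtain ⟨p, hp, ep⟩ := h.up i hi k r s ni
          refine absurd ep (hnew k r s ?_ p (lt_trans hp hi))
          rw [nodeContent_down hq, ← hxi, e]
      · rcases s with _ | s
        · have : nodeContent q v (k, r + 1, 0) = a ⟨l, hl⟩ := by
            refine mul_left_cancel₀ (pow_ne_zero 2 hq) ?_
            rw [← nodeContent_down hq, ← hxi, e]
          exact ⟨k, r + 1, 0, this, by simp, fun _ => ⟨i, hi, ni⟩, hnew _ _ _ this⟩
        · obtain ⟨p, hp, ep⟩ := h.left i hi k r s ni
          refine absurd ep (hnew k r s ?_ p (lt_trans hp hi))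
          refine mul_left_cancel₀ (pow_ne_zero 2 hq) ?_
          rw [← nodeContent_right hq, ← hxi, e]

end IsStandardUpTo

theorem IsLocalContent.exists_node (hg : IsGeneric n q v) {a : Fin n → K}
    (ha : IsLocalContent q v a) (hn : 0 < n) : ∃ node : Fin n → Fin m × ℕ × ℕ,
    IsStandardUpTo n node ∧ ∀ i, nodeContent q v (node i) = a i := by
  suffices H : ∀ l ≤ n, ∃ node : Fin n → Fin m × ℕ × ℕ,
      IsStandardUpTo l node ∧ ∀ i : Fin n, (i : ℕ) < l → nodeContent q v (node i) = a i by
    obtain ⟨node, h, e⟩ := H n le_rfl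
    exact ⟨node, h, fun i => e i i.2⟩
  intro l
  induction l with
  | zero =>
    intro _
    -- The numbering needs dummy values, and `m` might be `0`; the first entry of `a` supplies an
    -- index.
    obtain ⟨k, -⟩ := ha.exists_entry hg.q_ne_zero ⟨0, hn⟩
    exact ⟨fun _ => (k, 0, 0), ⟨by simp, by simp, by simp⟩, by simp⟩
  | succ l ih =>
    intro hl
    obtain ⟨node, h, hc⟩ := ih (by omega)
    obtain ⟨k, r, s, e, hs, hr, hnew⟩ := h.exists_new_node hg ha hl hc
    refine ⟨_, h.update hl k r s hs hr hnew, fun i hi => ?_⟩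
    by_cases hil : i = ⟨l, hl⟩
    · rw [hil, Function.update_self, e]
    · rw [Function.update_of_ne hil]
      refine hc i ?_
      have : (i : ℕ) ≠ l := fun h => hil (Fin.ext h)
      omega

namespace StandardTableau

theorem isStandardUpTo (T : StandardTableau m n) : IsStandardUpTo n T.node := by
  have mem : ∀ x, x.2 ∈ T.shape x.1 ↔ ∃ i, T.node i = x := fun x => by
    have := Set.ext_iff.1 T.range_node x
    exact this.symm
  refine ⟨fun i j _ _ e => T.node_injective e, fun j _ k r s e => ?_, fun j _ k r s e => ?_⟩
  · have h1 : (r + 1, s) ∈ T.shape k := (mem (k, r + 1, s)).2 ⟨j, e⟩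
    have h2 : (r, s) ∈ T.shape k := (T.shape k).up_left_mem (Nat.le_succ r) le_rfl h1
    obtain ⟨i, hi⟩ := (mem (k, r, s)).1 h2
    exact ⟨i, T.col_lt i j (by rw [hi, e]) (by rw [hi, e]) (by rw [hi, e]; simp), hi⟩
  · have h1 : (r, s + 1) ∈ T.shape k := (mem (k, r, s + 1)).2 ⟨j, e⟩
    have h2 : (r, s) ∈ T.shape k := (T.shape k).up_left_mem le_rfl (Nat.le_succ s) h1
    obtain ⟨i, hi⟩ := (mem (k, r, s)).1 h2
    exact ⟨i, T.row_lt i j (by rw [hi, e]) (by rw [hi, e]) (by rw [hi, e]; simp), hi⟩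

theorem eq_of_node_eq {T T' : StandardTableau m n} (h : T.node = T'.node) : T = T' := by
  have hs : T.shape = T'.shape := by
    funext k
    ext x
    have h1 := Set.ext_iff.1 T.range_node (k, x)
    have h2 := Set.ext_iff.1 T'.range_node (k, x)
    rw [h] at h1
    exact h1.symm.trans h2
  cases T
  cases T'
  simp only at h hs
  subst h hs
  rfl

/-- The tableau with a given numbering of nodes. -/
def ofNode (node : Fin n → Fin m × ℕ × ℕ) (h : IsStandardUpTo n node) : StandardTableau m n where
  shape k :=
    { cells := (Finset.univ.filter fun i => (node i).1 = k).image fun i => (node i).2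
      isLowerSet := by
        rintro ⟨r', s'⟩ ⟨r, s⟩ hle hmem
        simp only [Finset.coe_image, Finset.coe_filter, Finset.mem_univ, true_and, Set.mem_image,
          Set.mem_ofPred_eq] at hmem ⊢
        obtain ⟨j, rfl, hj⟩ := hmem
        obtain ⟨i, -, hi⟩ := h.exists_le j.2 (k := (node j).1) (r' := r') (s' := s')
          (Prod.ext rfl hj) hle.1 hle.2
        exact ⟨i, by rw [hi], by rw [hi]⟩ }
  node := node
  node_injective i j e := h.injOn i j i.2 j.2 e
  range_node := by
    ext ⟨k, x⟩
    simp only [Set.mem_range, Set.mem_ofPred_eq, YoungDiagram.mem_mk, Finset.mem_image,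
      Finset.mem_filter, Finset.mem_univ, true_and]
    exact exists_congr fun i => Prod.ext_iff
  row_lt i j hk hr hs := by
    refine lt_of_le_of_ne (h.le_of_le i.2 j.2 (k := (node i).1) (r := (node i).2.1)
      (s := (node i).2.2) (r' := (node j).2.1) (s' := (node j).2.2) rfl
      (Prod.ext hk.symm rfl) hr.le hs.le) ?_
    rintro rfl
    exact lt_irrefl _ hs
  col_lt i j hk hs hr := by
    refine lt_of_le_of_ne (h.le_of_le i.2 j.2 (k := (node i).1) (r := (node i).2.1)
      (s := (node i).2.2) (r' := (node j).2.1) (s' := (node j).2.2) rfl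
      (Prod.ext hk.symm rfl) hr.le hs.le) ?_
    rintro rfl
    exact lt_irrefl _ hr

theorem bijOn_contentString (hg : IsGeneric n q v) (hn : 0 < n) :
    Set.BijOn (contentString q v) (Set.univ : Set (StandardTableau m n))
      {a | IsLocalContent q v a} := by
  refine ⟨fun T _ => T.isStandardUpTo.isLocalContent hg, fun T _ T' _ e => ?_, fun a ha => ?_⟩
  · exact eq_of_node_eq (T.isStandardUpTo.eq_of_nodeContent_eq hg T'.isStandardUpTo (congrFun e))
  · obtain ⟨node, h, e⟩ := IsLocalContent.exists_node hg ha hn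
    exact ⟨ofNode node h, trivial, funext e⟩

end StandardTableau

end Tableaux

/-! ### Relations in the Hecke algebra -/

section Relations

variable {K : Type u} [Field K] {m n : ℕ} (q : K) (v : Fin m → K)

theorem sigma_braid (i j : Fin (n - 1)) (h : (i : ℕ) + 1 = j) :
    sigma q v i * sigma q v j * sigma q v i = sigma q v j * sigma q v i * sigma q v j := by
  have := RingQuot.mkAlgHom_rel K (Rel.braid (q := q) (v := v) i j h)
  simp only [map_mul] at this
  exact this

theorem sigma_commute (i j : Fin (n - 1)) (h : (i : ℕ) + 1 < j ∨ (j : ℕ) + 1 < i) :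
    Commute (sigma q v i) (sigma q v j) := by
  have key : ∀ i j : Fin (n - 1), (i : ℕ) + 1 < j → Commute (sigma q v i) (sigma q v j) :=
    fun i j h => by
      have := RingQuot.mkAlgHom_rel K (Rel.far_comm (q := q) (v := v) i j h)
      simp only [map_mul] at this
      exact this
  exact h.elim (key i j) fun h => (key j i h).symm

theorem tau_commute (i : Fin (n - 1)) (h : 0 < (i : ℕ)) :
    Commute (tau q v) (sigma q v i) := by
  have := RingQuot.mkAlgHom_rel K (Rel.tau_comm (q := q) (v := v) i h)
  simp only [map_mul] at this
  exact this

theorem sigma_mul_self (i : Fin (n - 1)) :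
    sigma q v i * sigma q v i = (q - q⁻¹) • sigma q v i + 1 := by
  have := RingQuot.mkAlgHom_rel K (Rel.quadratic (q := q) (v := v) i)
  simp only [pow_two, map_mul, map_add, map_smul, map_one] at this
  exact this

theorem prod_tau_sub : (List.ofFn fun k =>
    tau q v - algebraMap K (HeckeAlgebra n q v) (v k)).prod = 0 := by
  have := RingQuot.mkAlgHom_rel K (Rel.cyclotomic (n := n) (q := q) (v := v))
  rw [map_zero, map_list_prod, List.map_ofFn] at this
  rw [← this]
  congr 2
  funext k
  simp only [Function.comp_apply, map_sub, AlgHom.commutes]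
  rfl

theorem jucysMurphy_succ (i : ℕ) (h : i + 1 < n) : jucysMurphy q v (i + 1) h =
    sigma q v ⟨i, by omega⟩ * jucysMurphy q v i (by omega) * sigma q v ⟨i, by omega⟩ := rfl

/-- `σ_i` commutes with the Jucys–Murphy elements other than `J_i` and `J_{i+1}`. -/
theorem sigma_commute_jucysMurphy (i : Fin (n - 1)) (k : ℕ) (hk : k < n) (h0 : k ≠ i)
    (h1 : k ≠ i + 1) : Commute (sigma q v i) (jucysMurphy q v k hk) := by
  have below : ∀ (k : ℕ) (hk : k < n) (i : Fin (n - 1)), k < i →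
      Commute (sigma q v i) (jucysMurphy q v k hk) := by
    intro k
    induction k with
    | zero => intro hk i hi; exact (tau_commute q v i hi).symm
    | succ k ih =>
      intro hk i hi
      have hs := sigma_commute q v i ⟨k, by omega⟩ (Or.inr hi)
      exact (hs.mul_right (ih _ i (by omega))).mul_right hs
  rcases lt_or_gt_of_ne h0 with h | h
  · exact below k hk i h
  have above : ∀ (d : ℕ) (hk : (i : ℕ) + 2 + d < n),
      Commute (sigma q v i) (jucysMurphy q v (i + 2 + d) hk) := by
    intro d
    induction d with
    | zero =>
      intro hk
      have hb := sigma_braid q v i ⟨i + 1, by omega⟩ rfl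
      have hc := below i (by omega) ⟨i + 1, by omega⟩ (Nat.lt_succ_self i)
      have e : jucysMurphy q v (i + 2) hk = sigma q v ⟨i + 1, by omega⟩ *
        (sigma q v i * jucysMurphy q v i (by omega) * sigma q v i) *
          sigma q v ⟨i + 1, by omega⟩ := rfl
      change _ * jucysMurphy q v (i + 2) hk = jucysMurphy q v (i + 2) hk * _
      rw [e]
      generalize sigma q v i = s at *
      generalize sigma q v ⟨i + 1, _⟩ = t at *
      generalize jucysMurphy q v i _ = x at *
      -- With `s, t` the neighbouring generators and `x = J_i`, the braid relation carries `s`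
      -- across `t s x s t` because `t` commutes with `x`.
      calc s * (t * (s * x * s) * t) = (s * t * s) * x * s * t := by simp only [mul_assoc]
        _ = t * s * (t * x) * s * t := by rw [hb]; simp only [mul_assoc]
        _ = t * s * x * (t * s * t) := by rw [hc.eq]; simp only [mul_assoc]
        _ = t * (s * x * s) * t * s := by rw [← hb]; simp only [mul_assoc]
    | succ d ih =>
      intro hk
      have hs := sigma_commute q v i ⟨i + 2 + d, by omega⟩ (Or.inl (by simp; omega))
      exact (hs.mul_right (ih _)).mul_right hs
  obtain ⟨d, rfl⟩ : ∃ d, k = i + 2 + d := ⟨k - (i + 2), by omega⟩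
  exact above d hk

end Relations

/-! ### Joint eigenvectors of two neighbouring Jucys–Murphy elements -/

section Local

variable {K : Type u} [Field K] {V : Type u} [AddCommGroup V] [Module K V]

/-- An eigenvector of a generalized eigenvalue of a diagonalizable operator. -/
theorem eq_zero_of_sub_sub_eq_zero {X : Module.End K V}
    (hX : ⨆ μ : K, Module.End.eigenspace X μ = ⊤) {b : K} {w : V}
    (h : X (X w - b • w) = b • (X w - b • w)) : X w = b • w := by
  -- The `b`-component of `w` is killed by `X - b`, so `X w - b • w` lies in the sum `U` of the
  -- other eigenspaces. By hypothesis it also lies in the `b`-eigenspace, hence it vanishes.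
  set U := ⨆ (μ : K) (_ : μ ≠ b), Module.End.eigenspace X μ with hU
  have hinv : U ≤ U.comap X := by
    refine iSup₂_le fun μ hμ x hx => ?_
    rw [Submodule.mem_comap, Module.End.mem_eigenspace_iff.1 hx]
    exact Submodule.smul_mem _ _ ((le_iSup₂ (f := fun (μ : K) (_ : μ ≠ b) =>
      Module.End.eigenspace X μ) μ hμ) hx)
  have hw : w ∈ Module.End.eigenspace X b ⊔ U := by
    rw [hU, ← iSup_split_single, hX]
    trivial
  obtain ⟨x, hx, y, hy, rfl⟩ := Submodule.mem_sup.1 hw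
  have hx' := Module.End.mem_eigenspace_iff.1 hx
  rw [← sub_eq_zero]
  have e : X (x + y) - b • (x + y) = X y - b • y := by
    rw [map_add, hx', smul_add, add_sub_add_left_eq_sub]
  refine Submodule.disjoint_def.1 (Module.End.eigenspaces_iSupIndep X b) _
    (Module.End.mem_eigenspace_iff.2 h) ?_
  rw [e]
  exact U.sub_mem (hinv hy) (U.smul_mem b hy)

variable {q : K} {S X : Module.End K V} {e : V} {a b : K}

/-- Apply `S` to `hY` and use the quadratic relation. With `apply_sigma_of_eigenvector'` this gives
the action of `J_i` and `J_{i+1}` on the span of `e` and `S e`. -/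
theorem apply_sigma_of_eigenvector (hS : ∀ x, S (S x) = (q - q⁻¹) • S x + x)
    (hY : S (X (S e)) = b • e) : X (S e) = b • S e - ((q - q⁻¹) * b) • e := by
  have := hS (X (S e))
  rw [hY, map_smul] at this
  rw [this, smul_smul]
  abel

theorem apply_sigma_of_eigenvector' (hS : ∀ x, S (S x) = (q - q⁻¹) • S x + x)
    (hX : X e = a • e) (hY : S (X (S e)) = b • e) :
    S (X (S (S e))) = a • S e + ((q - q⁻¹) * b) • e := by
  rw [hS, map_add, map_smul, map_add, map_smul, hX, map_smul, hY, smul_smul]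
  abel

/-- In a completely reducible representation of the subalgebra generated by `J_i`, `J_{i+1}` and
`σ_i`, a joint eigenvector of `J_i` and `J_{i+1}` whose eigenvalues differ by the factor `c ^ 2`,
where `c` is an eigenvalue of `σ_i`, is an eigenvector of `σ_i`. -/
theorem sigma_apply_of_eq_sq_mul (hS : ∀ x, S (S x) = (q - q⁻¹) • S x + x)
    (hss : IsSemisimpleModule (Algebra.adjoin K ({X, S * X * S, S} : Set (Module.End K V))) V)
    (hX : X e = a • e) (hY : S (X (S e)) = b • e) (hab : a ≠ b) {c : K}
    (hc : c * c = (q - q⁻¹) * c + 1) (hcb : b = c * c * a) : S e = c • e := by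
  rw [← sub_eq_zero]
  set f := S e - c • e with hf
  -- The other root of the quadratic relation is `q - q⁻¹ - c = -c⁻¹`, so `f` is a common
  -- eigenvector of `S` and `X`.
  have hSf : S f = ((q - q⁻¹) - c) • f := by
    have : ((q - q⁻¹) - c) * c = -1 := by linear_combination -hc
    rw [hf, map_sub, map_smul, hS, smul_sub, smul_smul, this]
    module
  have hXf : X f = b • f := by
    have : (q - q⁻¹) * b + c * a = b * c := by
      rw [hcb]
      linear_combination (-(c * a)) * hc
    rw [hf, map_sub, map_smul, hX, apply_sigma_of_eigenvector hS hY, smul_sub, smul_smul, smul_smul,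
      ← this]
    module
  set A := Algebra.adjoin K ({X, S * X * S, S} : Set (Module.End K V)) with hA
  have hXA : X ∈ A := Algebra.subset_adjoin (by simp)
  have hSA : S ∈ A := Algebra.subset_adjoin (by simp)
  have hmul : ∀ T ∈ A, ∃ t : K, T f = t • f := by
    intro T hT
    induction hT using Algebra.adjoin_induction with
    | mem T hT =>
      rcases hT with rfl | rfl | rfl
      · exact ⟨_, hXf⟩
      · refine ⟨((q - q⁻¹) - c) * b * ((q - q⁻¹) - c), ?_⟩
        rw [Module.End.mul_apply, Module.End.mul_apply, hSf, map_smul, hXf, map_smul, map_smul, hSf]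
        module
      · exact ⟨_, hSf⟩
    | algebraMap r => exact ⟨r, rfl⟩
    | add T T' _ _ h h' =>
      obtain ⟨t, ht⟩ := h
      obtain ⟨t', ht'⟩ := h'
      exact ⟨t + t', by rw [LinearMap.add_apply, ht, ht', add_smul]⟩
    | mul T T' _ _ h h' =>
      obtain ⟨t, ht⟩ := h
      obtain ⟨t', ht'⟩ := h'
      exact ⟨t' * t, by rw [Module.End.mul_apply, ht', map_smul, ht, smul_smul]⟩
  -- The submodule generated by `f` lies in the `b`-eigenspace of `X`, while `e` has eigenvalue `a ≠
  -- b`. The component `y` of `e` in it is therefore zero, so `e`, and with it `f`, lies in the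
  -- complement.
  obtain ⟨U, hU⟩ := exists_isCompl (Submodule.span A {f})
  have he : e ∈ Submodule.span A {f} ⊔ U := by rw [hU.sup_eq_top]; trivial
  obtain ⟨y, hy, w, hw, hyw⟩ := Submodule.mem_sup.1 he
  have hyb : X y = b • y := by
    obtain ⟨T, rfl⟩ := Submodule.mem_span_singleton.1 hy
    obtain ⟨t, ht⟩ := hmul T T.2
    have : T • f = t • f := ht
    rw [this, map_smul, hXf, smul_comm]
  have hKU : ∀ (t : K) (w : V), w ∈ U → t • w ∈ U := fun t w hw => by
    rw [← algebraMap_smul A t w]; exact U.smul_mem _ hw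
  have hKf : ∀ (t : K) (w : V), w ∈ Submodule.span A {f} → t • w ∈ Submodule.span A {f} :=
    fun t w hw => by rw [← algebraMap_smul A t w]; exact Submodule.smul_mem _ _ hw
  have hdiff : (b - a) • y ∈ U := by
    have : (b - a) • y = a • w - X w := by
      rw [← hyw, map_add, hyb, smul_add] at hX
      rw [sub_smul, sub_eq_sub_iff_add_eq_add, hX, add_comm]
    rw [this]
    exact U.sub_mem (hKU a w hw) (U.smul_mem ⟨X, hXA⟩ hw)
  have h0 := Submodule.disjoint_def.1 hU.disjoint _ (hKf (b - a) y hy) hdiff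
  have hy0 : y = 0 := (smul_eq_zero.1 h0).resolve_left (sub_ne_zero.2 hab.symm)
  have hfU : f ∈ U := by
    rw [hf, ← hyw, hy0, zero_add]
    exact U.sub_mem (U.smul_mem ⟨S, hSA⟩ hw) (hKU c w hw)
  exact Submodule.disjoint_def.1 hU.disjoint _ (Submodule.mem_span_singleton_self f) hfU

end Local

/-! ### From admissible transpositions to content conditions -/

section Combinatorics

variable {K : Type u} [Field K] {m n : ℕ} {q : K} {v : Fin m → K}

/-- A set of strings which is stable under admissible transpositions and does not contain the
forbidden segments consists of content strings. -/
theorem isLocalContent_of_swap_mem (hq : q ≠ 0) (W : Set (Fin n → K))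
    (h0 : ∀ a ∈ W, ∀ j : Fin n, (j : ℕ) = 0 → a j ∈ Set.range v)
    (hne : ∀ a ∈ W, ∀ i j : Fin n, (i : ℕ) + 1 = j → a i ≠ a j)
    (hswap : ∀ a ∈ W, ∀ i j : Fin n, (i : ℕ) + 1 = j → a j ≠ q ^ 2 * a i → a i ≠ q ^ 2 * a j →
      a ∘ Equiv.swap i j ∈ W)
    (htriple : ∀ a ∈ W, ∀ i j k : Fin n, (i : ℕ) + 1 = j → (j : ℕ) + 1 = k → a i = a k →
      a j ≠ q ^ 2 * a i ∧ a i ≠ q ^ 2 * a j) :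
    ∀ a ∈ W, IsLocalContent q v a := by
  intro a ha
  refine ⟨fun j => ?_, fun i j hij e => ?_⟩
  -- Move the entry to the left by admissible transpositions until it meets a linked neighbour or
  -- reaches the first position.
  · obtain ⟨l, hl⟩ : ∃ l : ℕ, (j : ℕ) = l := ⟨_, rfl⟩
    induction l generalizing a j with
    | zero => exact Or.inl (h0 a ha j hl)
    | succ l ih =>
      let i : Fin n := ⟨l, by omega⟩
      have hij : (i : ℕ) + 1 = j := hl.symm
      have hlt : i < j := by rw [Fin.lt_def]; omega
      by_cases h1 : a j = q ^ 2 * a i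
      · exact Or.inr ⟨i, hlt, Or.inl h1⟩
      by_cases h2 : a i = q ^ 2 * a j
      · exact Or.inr ⟨i, hlt, Or.inr h2⟩
      rcases ih _ (hswap a ha i j hij h1 h2) i rfl with h | ⟨p, hp, h⟩
      · exact Or.inl (by simpa using h)
      · refine Or.inr ⟨p, hp.trans hlt, ?_⟩
        simpa [Equiv.swap_apply_of_ne_of_ne hp.ne (hp.trans hlt).ne] using h
  -- Strong induction on the distance `d`, for both values of `r` at once. In a counterexample the
  -- value `a i` does not recur inside, and the two inner neighbours of the ends equal `r⁻¹ * a i`,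
  -- since otherwise a transposition shortens the segment. If these neighbours are distinct
  -- positions, induction between them yields `a i` inside; if they coincide, the segment is a
  -- forbidden triple.
  · have key : ∀ r : K, r = q ^ 2 ∨ r = (q ^ 2)⁻¹ → ∃ k, i < k ∧ k < j ∧ a k = r * a i := by
      obtain ⟨d, hd⟩ : ∃ d : ℕ, (i : ℕ) + d = j := ⟨j - i, by have : (i : ℕ) < j := hij; omega⟩
      induction d using Nat.strong_induction_on generalizing a i j with | _ d ih
      intro r hr
      have h2 : q ^ 2 ≠ 0 := pow_ne_zero 2 hq
      have hr0 : r ≠ 0 := by rcases hr with rfl | rfl <;> simp [hq]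
      have hr' : r⁻¹ = q ^ 2 ∨ r⁻¹ = (q ^ 2)⁻¹ := by rcases hr with rfl | rfl <;> simp
      have hrel : ∀ x y : K, y ≠ r * x → y ≠ r⁻¹ * x → y ≠ q ^ 2 * x ∧ x ≠ q ^ 2 * y := by
        intro x y hy hy'
        have h3 : x = q ^ 2 * y → y = (q ^ 2)⁻¹ * x := by rintro rfl; rw [inv_mul_cancel_left₀ h2]
        rcases hr with rfl | rfl
        · exact ⟨hy, fun h => hy' (h3 h)⟩
        · exact ⟨fun h => hy' (by rwa [inv_inv]), fun h => hy (h3 h)⟩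
      have hrel' : ∀ x y : K, y = r⁻¹ * x → y = q ^ 2 * x ∨ x = q ^ 2 * y := by
        rintro x y rfl
        rcases hr with rfl | rfl
        · right; rw [mul_inv_cancel_left₀ h2]
        · left; rw [inv_inv]
      by_contra! hno
      have hlt : (i : ℕ) < j := hij
      have hnox : ∀ k, i < k → k < j → a k ≠ a i := by
        intro k hik hkj hk
        have hik' : (i : ℕ) < k := hik
        have hkj' : (k : ℕ) < j := hkj
        obtain ⟨l, h3, h4, h5⟩ := ih (k - i) (by omega) a ha i k hik hk.symm (by omega) r hr
        exact hno l h3 (h4.trans hkj) h5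
      have hd1 : (i : ℕ) + 1 ≠ j := fun h => hne a ha i j h e
      let p : Fin n := ⟨j - 1, by omega⟩
      let s : Fin n := ⟨i + 1, by omega⟩
      have hpj : (p : ℕ) + 1 = j := by simp only [p]; omega
      have his : (i : ℕ) + 1 = s := rfl
      have hip : i < p := by rw [Fin.lt_def]; omega
      have hpj' : p < j := by rw [Fin.lt_def]; omega
      have his' : i < s := by rw [Fin.lt_def]; omega
      have hsj : s < j := by rw [Fin.lt_def]; omega
      have hp : a p = r⁻¹ * a i := by
        by_contra hp
        obtain ⟨h3, h4⟩ := hrel _ _ (hno p hip hpj') hp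
        rw [e] at h3 h4
        obtain ⟨k, hik, hkp, hk⟩ := ih (p - i) (by omega) _ (hswap a ha p j hpj h4 h3) i p hip
          (by simp [Equiv.swap_apply_of_ne_of_ne hip.ne hij.ne, e]) (by omega) r hr
        rw [Function.comp_apply, Function.comp_apply, Equiv.swap_apply_of_ne_of_ne hip.ne hij.ne,
          Equiv.swap_apply_of_ne_of_ne hkp.ne (hkp.trans hpj').ne] at hk
        exact hno k hik (hkp.trans hpj') hk
      have hs : a s = r⁻¹ * a i := by
        by_contra hs
        obtain ⟨h3, h4⟩ := hrel _ _ (hno s his' hsj) hs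
        obtain ⟨k, hik, hkp, hk⟩ := ih (j - s) (by omega) _ (hswap a ha i s his h3 h4) s j hsj
          (by simp [Equiv.swap_apply_of_ne_of_ne hij.ne' hsj.ne', e]) (by omega) r hr
        rw [Function.comp_apply, Function.comp_apply, Equiv.swap_apply_right,
          Equiv.swap_apply_of_ne_of_ne (his'.trans hik).ne' hik.ne'] at hk
        exact hno k (his'.trans hik) hkp hk
      rcases lt_or_ge s p with hsp | hsp
      · have hsp' : (s : ℕ) < p := hsp
        obtain ⟨k, hsk, hkp, hk⟩ := ih (p - s) (by omega) a ha s p hsp (hs.trans hp.symm)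
          (by omega) r hr
        rw [hs, mul_inv_cancel_left₀ hr0] at hk
        exact hnox k (his'.trans hsk) (hkp.trans hpj') hk
      · have hsp' : (p : ℕ) ≤ s := hsp
        obtain ⟨h3, h4⟩ := htriple a ha i s j his (by rw [Fin.lt_def] at hip; omega) e
        exact (hrel' _ _ hs).elim h3 h4
    obtain ⟨k, hk1, hk2, hk⟩ := key _ (Or.inr rfl)
    exact ⟨key _ (Or.inl rfl), k, hk1, hk2, by
      rw [hk, mul_inv_cancel_left₀ (pow_ne_zero 2 hq)]⟩

end Combinatorics

/-! ### Joint spectra of `C`-representations -/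

section Spectrum

variable {K : Type u} [Field K] {m n : ℕ} {q : K} {v : Fin m → K}
  {V : Type u} [AddCommGroup V] [Module K V] {ρ : HeckeAlgebra n q v →ₐ[K] Module.End K V}

/-- The strings of joint eigenvalues of the Jucys–Murphy elements in a representation. -/
def weights (ρ : HeckeAlgebra n q v →ₐ[K] Module.End K V) : Set (Fin n → K) :=
  {a | ∃ e : V, e ≠ 0 ∧ ∀ i : Fin n, ρ (jucysMurphy q v i i.isLt) e = a i • e}

theorem sigma_apply_sigma (ρ : HeckeAlgebra n q v →ₐ[K] Module.End K V) (i : Fin (n - 1)) (x : V) :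
    ρ (sigma q v i) (ρ (sigma q v i) x) = (q - q⁻¹) • ρ (sigma q v i) x + x := by
  rw [← Module.End.mul_apply, ← map_mul, sigma_mul_self, map_add, map_smul, map_one]
  rfl

theorem sigma_injective (ρ : HeckeAlgebra n q v →ₐ[K] Module.End K V) (i : Fin (n - 1)) (x : V)
    (h : ρ (sigma q v i) x = 0) : x = 0 := by
  simpa [h] using (sigma_apply_sigma ρ i x).symm

theorem prod_ofFn_sub_apply {n : ℕ} (T : Module.End K V) (w : Fin n → K) {e : V} {a : K}
    (h : T e = a • e) : (List.ofFn fun k => T - algebraMap K (Module.End K V) (w k)).prod e =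
      (∏ k, (a - w k)) • e := by
  induction n with
  | zero => simp
  | succ n ih =>
    rw [List.ofFn_succ, List.prod_cons, Module.End.mul_apply, ih, Fin.prod_univ_succ, map_smul,
      LinearMap.sub_apply, h, Module.algebraMap_end_apply, ← sub_smul, smul_smul, mul_comm]

theorem tau_eigenvalue (ρ : HeckeAlgebra n q v →ₐ[K] Module.End K V) {e : V} (he : e ≠ 0) {a : K}
    (h : ρ (tau q v) e = a • e) : a ∈ Set.range v := by
  have h1 := congrArg (fun x => ρ x e) (prod_tau_sub (n := n) q v)
  simp only [map_list_prod, List.map_ofFn, Function.comp_def, map_sub, AlgHom.commutes,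
    map_zero, LinearMap.zero_apply] at h1
  rw [prod_ofFn_sub_apply _ _ h] at h1
  obtain ⟨k, -, hk⟩ := Finset.prod_eq_zero_iff.1 ((smul_eq_zero.1 h1).resolve_right he)
  exact ⟨k, (sub_eq_zero.1 hk).symm⟩

/-- The Jucys–Murphy elements act injectively: each `σ` does by its quadratic relation, and `τ` does
because its eigenvalues are among the nonzero `v k`. -/
theorem weights_ne_zero (hv : ∀ k, v k ≠ 0) {e : V} (he : e ≠ 0) (i : ℕ) (hi : i < n) {b : K}
    (h : ρ (jucysMurphy q v i hi) e = b • e) : b ≠ 0 := by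
  rintro rfl
  rw [zero_smul] at h
  induction i generalizing e with
  | zero =>
    obtain ⟨k, hk⟩ := tau_eigenvalue ρ he (a := 0) (by rw [zero_smul]; exact h)
    exact hv k hk
  | succ i ih =>
    rw [jucysMurphy_succ, map_mul, map_mul, Module.End.mul_apply, Module.End.mul_apply] at h
    exact he (sigma_injective ρ _ _ (by_contra fun hne =>
      ih hne (by omega) (sigma_injective ρ _ _ h)))

variable {a : Fin n → K} {e : V}

theorem sigma_jucysMurphy_sigma_apply (he : ∀ i : Fin n, ρ (jucysMurphy q v i i.isLt) e = a i • e)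
    {i j : Fin n} (hij : (i : ℕ) + 1 = j) :
    ρ (sigma q v ⟨i, by omega⟩) (ρ (jucysMurphy q v i i.isLt) (ρ (sigma q v ⟨i, by omega⟩) e)) =
      a j • e := by
  rw [← he j, ← Module.End.mul_apply, ← Module.End.mul_apply, ← map_mul, ← map_mul]
  obtain ⟨i, hi⟩ := i
  obtain ⟨j, hj⟩ := j
  obtain rfl : i + 1 = j := hij
  rw [jucysMurphy_succ, mul_assoc]

/-- If both eigenvalues were `x`, then `J_i (σ e) = x σ e - (q - q⁻¹) x e`. Diagonalizability of
`J_i` forces the last term to vanish, although no factor in it is zero. -/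
theorem weights_ne (hq : q - q⁻¹ ≠ 0) (hv : ∀ k, v k ≠ 0) (hρ : IsCRepresentation ρ) (h0 : e ≠ 0)
    (he : ∀ i : Fin n, ρ (jucysMurphy q v i i.isLt) e = a i • e) {i j : Fin n}
    (hij : (i : ℕ) + 1 = j) : a i ≠ a j := by
  intro hab
  have h1 := apply_sigma_of_eigenvector (sigma_apply_sigma ρ ⟨i, by omega⟩)
    (sigma_jucysMurphy_sigma_apply he hij)
  have h2 : ρ (jucysMurphy q v i i.isLt) (ρ (sigma q v ⟨i, by omega⟩) e) =
      a j • ρ (sigma q v ⟨i, by omega⟩) e := by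
    refine eq_zero_of_sub_sub_eq_zero (hρ.diagonalizable i i.2) ?_
    rw [h1, sub_sub_cancel_left, map_neg, map_smul, he i, hab, smul_neg, smul_comm]
  rw [h2, eq_comm, sub_eq_self, smul_eq_zero] at h1
  rcases h1 with h1 | h1
  · exact mul_ne_zero hq (weights_ne_zero hv h0 j j.2 (he j)) h1
  · exact h0 h1

theorem sigma_apply_of_isCRepresentation (hq : q - q⁻¹ ≠ 0) (hv : ∀ k, v k ≠ 0)
    (hρ : IsCRepresentation ρ) (h0 : e ≠ 0)
    (he : ∀ i : Fin n, ρ (jucysMurphy q v i i.isLt) e = a i • e) {i j : Fin n}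
    (hij : (i : ℕ) + 1 = j) {c : K} (hc : c * c = (q - q⁻¹) * c + 1)
    (hcb : a j = c * c * a i) : ρ (sigma q v ⟨i, by omega⟩) e = c • e := by
  refine sigma_apply_of_eq_sq_mul (sigma_apply_sigma ρ ⟨i, by omega⟩) ?_ (he i)
    (sigma_jucysMurphy_sigma_apply he hij) (weights_ne hq hv hρ h0 he hij) hc hcb
  have := hρ.completely_reducible i (by omega)
  rwa [jucysMurphy_succ, map_mul, map_mul] at this

/-- The vector is `σ e - d e`, with `d` chosen to make it an eigenvector of `J_i` with eigenvalue `a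
j`. If it vanished, `d` would be a root `q` or `-q⁻¹` of the quadratic relation and `a j = d ^ 2 * a
i`, against `h1` or `h2`. -/
theorem swap_mem_weights (hq0 : q ≠ 0) (hq : q - q⁻¹ ≠ 0) (hv : ∀ k, v k ≠ 0)
    (hρ : IsCRepresentation ρ) (ha : a ∈ weights ρ) {i j : Fin n} (hij : (i : ℕ) + 1 = j)
    (h1 : a j ≠ q ^ 2 * a i) (h2 : a i ≠ q ^ 2 * a j) : a ∘ Equiv.swap i j ∈ weights ρ := by
  obtain ⟨e, h0, he⟩ := ha
  have hab := weights_ne hq hv hρ h0 he hij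
  have hS := sigma_apply_sigma ρ ⟨i, by omega⟩
  have hY := sigma_jucysMurphy_sigma_apply he hij
  set S := ρ (sigma q v ⟨i, by omega⟩) with hSdef
  set d := (q - q⁻¹) * a j / (a j - a i) with hd
  have hd' : d * (a j - a i) = (q - q⁻¹) * a j := div_mul_cancel₀ _ (sub_ne_zero.2 hab.symm)
  clear_value d
  refine ⟨S e - d • e, fun h => ?_, fun k => ?_⟩
  · rw [sub_eq_zero] at h
    rw [h, map_smul, map_smul, he i, map_smul, h, smul_smul, smul_smul] at hY
    have hb : d * a i * d = a j := smul_left_injective K h0 hY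
    have hdd := hS e
    rw [h, map_smul, h, smul_smul, smul_smul] at hdd
    have hdd' : d * d = (q - q⁻¹) * d + 1 := by
      refine smul_left_injective K h0 ?_
      simp only [hdd, add_smul, one_smul]
    have : (d - q) * (q * d + 1) = 0 := by
      linear_combination q * hdd' - d * (mul_inv_cancel₀ hq0)
    rcases mul_eq_zero.1 this with h3 | h3
    · rw [sub_eq_zero] at h3
      exact h1 (by rw [← hb, h3]; ring)
    · apply h2
      rw [← hb]
      linear_combination (-(q * d - 1) * a i) * h3
  · rcases eq_or_ne k i with rfl | hki
    · rw [Function.comp_apply, Equiv.swap_apply_left, map_sub, map_smul, he k,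
        apply_sigma_of_eigenvector hS hY, smul_sub, ← hd', smul_smul, smul_smul]
      module
    rcases eq_or_ne k j with rfl | hkj
    · rw [Function.comp_apply, Equiv.swap_apply_right, map_sub, map_smul, he k]
      have : ρ (jucysMurphy q v k k.isLt) (S e) = a i • S e + ((q - q⁻¹) * a k) • e := by
        rw [← apply_sigma_of_eigenvector' hS (he i) hY]
        obtain ⟨k, hk⟩ := k
        obtain rfl : (i : ℕ) + 1 = k := hij
        rw [jucysMurphy_succ, map_mul, map_mul]
        rfl
      rw [this, smul_sub, ← hd', smul_smul, smul_smul]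
      module
    · rw [Function.comp_apply, Equiv.swap_apply_of_ne_of_ne hki hkj, map_sub, map_smul, he k]
      have hc := sigma_commute_jucysMurphy q v ⟨i, by omega⟩ k k.2 (fun h => hki (Fin.ext h))
        (fun h => hkj (Fin.ext (h.trans hij)))
      have : ρ (jucysMurphy q v k k.isLt) (S e) = a k • S e := by
        rw [hSdef, ← Module.End.mul_apply, ← map_mul, ← hc.eq, map_mul, Module.End.mul_apply, he k,
          map_smul]
      rw [this, smul_sub, smul_comm]

theorem isLocalContent_of_mem_weights (hg : IsGeneric n q v) (hρ : IsCRepresentation ρ)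
    (ha : a ∈ weights ρ) : IsLocalContent q v a := by
  have hq0 := hg.q_ne_zero
  have hv := hg.v_ne_zero
  have hq := sub_inv_ne_zero_of_sq_ne_one hq0 hg.sq_ne_one
  have hqi := mul_inv_cancel₀ hq0
  refine isLocalContent_of_swap_mem hq0 (weights ρ) ?_ ?_ ?_ ?_ a ha
  · rintro a ⟨e, h0, he⟩ j hj
    refine tau_eigenvalue ρ h0 ?_
    have := he j
    obtain ⟨j, hj'⟩ := j
    obtain rfl : j = 0 := hj
    exact this
  · rintro a ⟨e, h0, he⟩ i j hij
    exact weights_ne hq hv hρ h0 he hij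
  · intro a ha i j hij h1 h2
    exact swap_mem_weights hq0 hq hv hρ ha hij h1 h2
  · rintro a ⟨e, h0, he⟩ i j k hij hjk hik
    -- On a segment `x, c²x, x`, the two neighbouring generators act on `e` by `c` and by the other
    -- root `c' = -c⁻¹`. The braid relation forces `c = c'`, so `c² = -1`, and as `c` is `q` or
    -- `-q⁻¹` this means `1 + q ^ 2 = 0`.
    have key : ∀ c : K, c * c = (q - q⁻¹) * c + 1 → a j ≠ c * c * a i := by
      intro c hc hj
      set c' := q - q⁻¹ - c with hc'
      have hcc' : c * c' = -1 := by rw [hc']; linear_combination -hc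
      have hs := sigma_apply_of_isCRepresentation hq hv hρ h0 he hij hc hj
      have ht := sigma_apply_of_isCRepresentation hq hv hρ h0 he hjk (c := c')
        (by rw [hc']; linear_combination hc) (by
          rw [← hik, hj]; linear_combination (a i * (1 - c * c')) * hcc')
      have hb := congrArg (fun x => ρ x e) (sigma_braid q v ⟨i, by omega⟩ ⟨j, by omega⟩ hij)
      simp only [map_mul, Module.End.mul_apply, hs, ht, map_smul, smul_smul] at hb
      have hb' := smul_left_injective K h0 hb
      have hcc : c * c = -1 := by linear_combination (c * c - c * c' + 1) * hcc' - c * hb'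
      have hfac : (c - q) * (q * c + 1) = 0 := by
        linear_combination q * hc - c * hqi
      refine hg.one_add_sq_ne_zero (by omega) ?_
      rcases mul_eq_zero.1 hfac with h | h
      · linear_combination hcc - (c + q) * h
      · linear_combination q ^ 2 * hcc - (q * c - 1) * h
    constructor
    · intro h
      exact key q (by linear_combination hqi) (by rw [h]; ring)
    · intro h
      refine key (-q⁻¹) (by linear_combination hqi) ?_
      rw [h]
      field_simp

theorem isLocalContent_of_mem_jmSpec (hg : IsGeneric n q v) (ha : a ∈ jmSpec n q v) :
    IsLocalContent q v a := by
  obtain ⟨V, _, _, _, ρ, hρ, e, h0, he⟩ := ha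
  exact isLocalContent_of_mem_weights hg hρ ⟨e, h0, he⟩

end Spectrum

theorem comp_swap_comp_swap {n : ℕ} {α : Type*} (a : Fin n → α) (i j : Fin n) :
    (a ∘ Equiv.swap i j) ∘ Equiv.swap i j = a := by
  funext k
  simp

/-! ### Admissible transpositions of content strings -/

section Swap

variable {K : Type u} [Field K] {m n : ℕ} {q : K} {v : Fin m → K} {a : Fin n → K}

theorem IsLocalContent.ne_succ (ha : IsLocalContent q v a) {i j : Fin n} (hij : (i : ℕ) + 1 = j) :
    a i ≠ a j := by
  intro e
  obtain ⟨⟨k, hik, hkj, -⟩, -⟩ := ha.gap i j (by rw [Fin.lt_def]; omega) e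
  rw [Fin.lt_def] at hik hkj
  omega

/-- The single entry in between would be both `q ^ 2` and `q ^ (-2)` times `a i`, so `q ^ 4 = 1`. -/
theorem IsLocalContent.ne_succ_succ (hg : IsGeneric n q v) (ha : IsLocalContent q v a)
    {i j k : Fin n} (hij : (i : ℕ) + 1 = j) (hjk : (j : ℕ) + 1 = k) : a i ≠ a k := by
  intro e
  obtain ⟨⟨p, hip, hpk, hp⟩, ⟨p', hip', hpk', hp'⟩⟩ := ha.gap i k (by rw [Fin.lt_def]; omega) e
  rw [Fin.lt_def] at hip hpk hip' hpk'
  obtain rfl : p = j := Fin.ext (by omega)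
  obtain rfl : p' = p := Fin.ext (by omega)
  rw [hp, ← mul_assoc, ← pow_add] at hp'
  refine hg.zpow_ne_one 2 two_ne_zero (by rw [abs_two]; norm_cast; omega) ?_
  refine mul_right_cancel₀ (ha.ne_zero hg.q_ne_zero hg.v_ne_zero i) ?_
  rw [one_mul]
  exact_mod_cast hp'.symm

theorem swap_succ_lt {i j : Fin n} (hij : (i : ℕ) + 1 = j) {r t : Fin n} (h : r < t) :
    Equiv.swap i j r < Equiv.swap i j t ∨ r = i ∧ t = j := by
  simp only [Equiv.swap_apply_def]
  split_ifs <;> simp only [Fin.lt_def, Fin.ext_iff] at * <;> omega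

/-- Admissible transpositions preserve content strings. -/
theorem IsLocalContent.comp_swap (ha : IsLocalContent q v a) {i j : Fin n}
    (hij : (i : ℕ) + 1 = j) (h1 : a j ≠ q ^ 2 * a i) (h2 : a i ≠ q ^ 2 * a j) :
    IsLocalContent q v (a ∘ Equiv.swap i j) := by
  -- The transposition reverses the order of the positions `i, j` only. A required link could break
  -- only if these two entries were the linked ones, which `h1` and `h2` exclude.
  refine ⟨fun p => ?_, fun p t hpt e => ?_⟩
  · rcases ha.start (Equiv.swap i j p) with h | ⟨r, hr, h⟩
    · exact Or.inl h
    · refine Or.inr ⟨Equiv.swap i j r, ?_, by simpa using h⟩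
      rcases swap_succ_lt hij hr with h' | ⟨rfl, h'⟩
      · simpa using h'
      · rw [h'] at h
        exact (h.elim h1 h2).elim
  · simp only [Function.comp_apply] at e ⊢
    rcases swap_succ_lt hij hpt with h' | ⟨rfl, rfl⟩
    · obtain ⟨⟨k, hk1, hk2, hk⟩, ⟨l, hl1, hl2, hl⟩⟩ := ha.gap _ _ h' e
      constructor
      · refine ⟨Equiv.swap i j k, ?_, ?_, by simpa using hk⟩
        · rcases swap_succ_lt hij hk1 with h | ⟨h, rfl⟩
          · simpa using h
          · rw [h] at hk; exact absurd hk h1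
        · rcases swap_succ_lt hij hk2 with h | ⟨rfl, h⟩
          · simpa using h
          · rw [e, h] at hk; exact absurd hk h2
      · refine ⟨Equiv.swap i j l, ?_, ?_, by simpa using hl⟩
        · rcases swap_succ_lt hij hl1 with h | ⟨h, rfl⟩
          · simpa using h
          · rw [h] at hl; exact absurd hl h2
        · rcases swap_succ_lt hij hl2 with h | ⟨rfl, h⟩
          · simpa using h
          · rw [e, h] at hl; exact absurd hl h1
    · simp only [Equiv.swap_apply_left, Equiv.swap_apply_right] at e
      exact absurd e.symm (ha.ne_succ hij)

end Swap

/-! ### A criterion for complete reducibility -/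

section Semisimple

variable {K : Type*} [Field K] {V : Type*} [AddCommGroup V] [Module K V]

theorem mem_of_mem_adjoin {s : Set (Module.End K V)}
    {Q : Submodule K V} (h : ∀ T ∈ s, ∀ x ∈ Q, T x ∈ Q) {T : Module.End K V}
    (hT : T ∈ Algebra.adjoin K s) : ∀ x ∈ Q, T x ∈ Q := by
  induction hT using Algebra.adjoin_induction with
  | mem T hT => exact h T hT
  | algebraMap r => exact fun x hx => Q.smul_mem r hx
  | add T T' _ _ h h' => exact fun x hx => Q.add_mem (h x hx) (h' x hx)
  | mul T T' _ _ h h' => exact fun x hx => h _ (h' x hx)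

/-- A criterion for complete reducibility: the space is spanned by vectors each of which lies in
every invariant subspace meeting a given invariant neighbourhood of it. -/
theorem isSemisimpleModule_adjoin (s : Set (Module.End K V)) {ι : Type*} (e : ι → V)
    (Q : ι → Submodule K V) (hspan : Submodule.span K (Set.range e) = ⊤)
    (hQ : ∀ a, ∀ T ∈ s, ∀ x ∈ Q a, T x ∈ Q a) (heQ : ∀ a, e a ∈ Q a) (he : ∀ a, e a ≠ 0)
    (hgen : ∀ a, ∀ f ∈ Q a, f ≠ 0 → ∀ N : Submodule K V, (∀ T ∈ s, ∀ x ∈ N, T x ∈ N) → f ∈ N →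
      e a ∈ N) : IsSemisimpleModule (Algebra.adjoin K s) V := by
  set A := Algebra.adjoin K s with hA
  -- The module is the sum of the cyclic submodules generated by the `e a`. Each is simple: it stays
  -- inside `Q a`, so any nonzero submodule of it contains `e a` by `hgen`.
  refine isSemisimpleModule_of_isSemisimpleModule_submodule'
    (p := fun a => Submodule.span A {e a}) (fun a => ?_) ?_
  · suffices IsSimpleModule A (Submodule.span A {e a}) from inferInstance
    rw [isSimpleModule_iff_isAtom]
    refine ⟨fun h => he a (Submodule.span_singleton_eq_bot.1 h), fun N hN => ?_⟩
    by_contra hbot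
    obtain ⟨f, hfN, hf0⟩ := (Submodule.ne_bot_iff _).1 hbot
    refine hN.not_ge ((Submodule.span_singleton_le_iff_mem _ _).2 ?_)
    obtain ⟨T, hT⟩ := Submodule.mem_span_singleton.1 (hN.le hfN)
    have hfQ : f ∈ Q a := hT ▸ mem_of_mem_adjoin (hQ a) T.2 _ (heQ a)
    exact hgen a f hfQ hf0 (N.restrictScalars K)
      (fun T hT x hx => N.smul_mem (⟨T, Algebra.subset_adjoin hT⟩ : A) hx) hfN
  · have h : Submodule.span K (Set.range e) ≤
        (⨆ a, Submodule.span A {e a}).restrictScalars K := by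
      rw [Submodule.span_le]
      rintro _ ⟨a, rfl⟩
      exact Submodule.mem_iSup_of_mem a (Submodule.mem_span_singleton_self _)
    rw [hspan] at h
    exact eq_top_iff.2 fun f _ => h trivial

end Semisimple

/-! ### Seminormal operators on functions of strings -/

section Operators

variable {K : Type u} [Field K] {n : ℕ} (q : K)

/-- The diagonal coefficient of the seminormal form. -/
def diagCoeff (x y : K) : K := (q - q⁻¹) * y / (y - x)

open Classical in
/-- The off-diagonal coefficient of the seminormal form. -/
noncomputable def offCoeff (x y : K) : K :=
  if y = q ^ 2 * x ∨ x = q ^ 2 * y then 0 else q⁻¹ * (y - q ^ 2 * x) / (y - x)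

variable {q}

theorem diagCoeff_add {x y : K} (h : x ≠ y) : diagCoeff q x y + diagCoeff q y x = q - q⁻¹ := by
  have h1 : y - x ≠ 0 := sub_ne_zero.2 h.symm
  rw [diagCoeff, diagCoeff, ← neg_sub y x, div_neg, ← sub_eq_add_neg, ← sub_div, ← mul_sub,
    mul_div_cancel_right₀ _ h1]

theorem mul_diagCoeff_add {x y : K} :
    x * diagCoeff q x y + y * diagCoeff q y x = 0 := by
  rw [diagCoeff, diagCoeff, ← neg_sub y x, div_neg]
  ring

/-- The right side has numerator factors `y - q ^ 2 * x` and `x - q ^ 2 * y`. It vanishes for linked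
entries, so `offCoeff` may be set to zero there in both orders without spoiling the quadratic
relation. -/
theorem offCoeff_mul (hq : q ≠ 0) {x y : K} (h : x ≠ y) :
    offCoeff q x y * offCoeff q y x = 1 + diagCoeff q x y * diagCoeff q y x := by
  have h1 : y - x ≠ 0 := sub_ne_zero.2 h.symm
  have h2 : x - y ≠ 0 := sub_ne_zero.2 h
  have e : 1 + diagCoeff q x y * diagCoeff q y x =
      (q⁻¹ * (y - q ^ 2 * x) / (y - x)) * (q⁻¹ * (x - q ^ 2 * y) / (x - y)) := by
    rw [diagCoeff, diagCoeff]
    field_simp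
    ring
  rw [e]
  unfold offCoeff
  by_cases h3 : y = q ^ 2 * x ∨ x = q ^ 2 * y
  · rw [if_pos h3, zero_mul]
    rcases h3 with h3 | h3
    · rw [sub_eq_zero.2 h3]; ring
    · rw [sub_eq_zero.2 h3]; ring
  · rw [if_neg h3, if_neg (fun h => h3 h.symm)]

theorem offCoeff_eq_zero_comm (hq : q ≠ 0) {x y : K} (h : offCoeff q x y = 0) :
    offCoeff q y x = 0 := by
  by_cases h1 : y = q ^ 2 * x ∨ x = q ^ 2 * y
  · exact if_pos h1.symm
  · rw [offCoeff, if_neg h1, div_eq_zero_iff, mul_eq_zero, inv_eq_zero, sub_eq_zero,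
      sub_eq_zero] at h
    rcases h with (h | h) | h
    · exact absurd h hq
    · exact absurd (Or.inl h) h1
    -- For equal entries the coefficient is `0` through division by `0`.
    · simp [offCoeff, h]

/-- This identity and `diagCoeff_triple'` are the braid relation at the coefficients of the strings
transposed at `i, j` and at `j, k`; the coefficient of `f a` follows from both together with
`offCoeff_mul`. -/
theorem diagCoeff_triple {x y z : K} (hxy : x ≠ y) (hyz : y ≠ z) (hxz : x ≠ z) :
    diagCoeff q x y * diagCoeff q y z + diagCoeff q x z * diagCoeff q y x =
      diagCoeff q y z * diagCoeff q x z := by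
  have h1 : y - x ≠ 0 := sub_ne_zero.2 hxy.symm
  have h2 : z - y ≠ 0 := sub_ne_zero.2 hyz.symm
  have h3 : z - x ≠ 0 := sub_ne_zero.2 hxz.symm
  simp only [diagCoeff]
  rw [← neg_sub y x]
  generalize q - q⁻¹ = t
  field_simp
  ring

theorem diagCoeff_triple' {x y z : K} (hxy : x ≠ y) (hyz : y ≠ z) (hxz : x ≠ z) :
    diagCoeff q y z * diagCoeff q x y + diagCoeff q x z * diagCoeff q z y =
      diagCoeff q x y * diagCoeff q x z := by
  have h1 : y - x ≠ 0 := sub_ne_zero.2 hxy.symm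
  have h2 : z - y ≠ 0 := sub_ne_zero.2 hyz.symm
  have h3 : z - x ≠ 0 := sub_ne_zero.2 hxz.symm
  simp only [diagCoeff]
  rw [← neg_sub z y]
  generalize q - q⁻¹ = t
  field_simp
  ring

variable (q)

/-- The action of `σ` at the positions `i` and `j` on functions of strings. -/
noncomputable def sigmaOp (i j : Fin n) : Module.End K ((Fin n → K) → K) where
  toFun f a := diagCoeff q (a i) (a j) * f a + offCoeff q (a i) (a j) * f (a ∘ Equiv.swap i j)
  map_add' f g := by funext a; simp only [Pi.add_apply]; ring
  map_smul' t f := by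
    funext a
    simp only [Pi.smul_apply, smul_eq_mul, RingHom.id_apply]
    ring

/-- Multiplication by the `i`-th entry on functions of strings. -/
def entryOp (i : Fin n) : Module.End K ((Fin n → K) → K) where
  toFun f a := a i * f a
  map_add' f g := by funext a; simp only [Pi.add_apply]; ring
  map_smul' t f := by
    funext a
    simp only [Pi.smul_apply, smul_eq_mul, RingHom.id_apply]
    ring

theorem sigmaOp_apply (i j : Fin n) (f : (Fin n → K) → K) (a : Fin n → K) : sigmaOp q i j f a =
    diagCoeff q (a i) (a j) * f a + offCoeff q (a i) (a j) * f (a ∘ Equiv.swap i j) := rfl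

theorem entryOp_apply (i : Fin n) (f : (Fin n → K) → K) (a : Fin n → K) :
    entryOp i f a = a i * f a := rfl

variable {q}

theorem sigmaOp_sigmaOp (hq : q ≠ 0) {i j : Fin n} (f : (Fin n → K) → K) {a : Fin n → K}
    (h : a i ≠ a j) :
    sigmaOp q i j (sigmaOp q i j f) a = (q - q⁻¹) * sigmaOp q i j f a + f a := by
  simp only [sigmaOp_apply, comp_swap_comp_swap, Function.comp_apply, Equiv.swap_apply_left,
    Equiv.swap_apply_right]
  rw [← diagCoeff_add h]
  linear_combination f a * offCoeff_mul hq h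

theorem sigmaOp_entryOp_sigmaOp (hq : q ≠ 0) {i j : Fin n} (f : (Fin n → K) → K) {a : Fin n → K}
    (h : a i ≠ a j) : sigmaOp q i j (entryOp i (sigmaOp q i j f)) a = a j * f a := by
  simp only [sigmaOp_apply, entryOp_apply, comp_swap_comp_swap, Function.comp_apply,
    Equiv.swap_apply_left, Equiv.swap_apply_right]
  linear_combination f a * a j * offCoeff_mul hq h +
    (f a * diagCoeff q (a i) (a j) + offCoeff q (a i) (a j) * f (a ∘ Equiv.swap i j)) *
      mul_diagCoeff_add (q := q) (x := a i) (y := a j)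

theorem sigmaOp_braid (hq : q ≠ 0) {i j k : Fin n} (hij : i ≠ j) (hjk : j ≠ k) (hik : i ≠ k)
    (f : (Fin n → K) → K) {a : Fin n → K} (h1 : a i ≠ a j) (h2 : a j ≠ a k) (h3 : a i ≠ a k) :
    sigmaOp q i j (sigmaOp q j k (sigmaOp q i j f)) a =
      sigmaOp q j k (sigmaOp q i j (sigmaOp q j k f)) a := by
  have hs : ((a ∘ Equiv.swap i j) ∘ Equiv.swap j k) ∘ Equiv.swap i j =
      ((a ∘ Equiv.swap j k) ∘ Equiv.swap i j) ∘ Equiv.swap j k := by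
    funext p
    simp only [Function.comp_apply]
    congr 1
    simp only [Equiv.swap_apply_def]
    split_ifs <;> simp_all
  simp only [sigmaOp_apply, comp_swap_comp_swap, hs, Function.comp_apply, Equiv.swap_apply_left,
    Equiv.swap_apply_right, Equiv.swap_apply_of_ne_of_ne hij hik,
    Equiv.swap_apply_of_ne_of_ne hik.symm hjk.symm]
  have e1 := offCoeff_mul hq h1
  have e2 := offCoeff_mul hq h2
  have t1 := diagCoeff_triple (q := q) h1 h2 h3
  have t2 := diagCoeff_triple' (q := q) h1 h2 h3
  linear_combination (f a * diagCoeff q (a i) (a k)) * (e1 - e2) +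
    (f (a ∘ Equiv.swap i j) * offCoeff q (a i) (a j)) * t1 -
    (f (a ∘ Equiv.swap j k) * offCoeff q (a j) (a k)) * t2 +
    f a * (diagCoeff q (a i) (a j) * t1 - diagCoeff q (a j) (a k) * t2)

theorem sigmaOp_comm {i j k l : Fin n} (hik : i ≠ k) (hil : i ≠ l) (hjk : j ≠ k) (hjl : j ≠ l)
    (f : (Fin n → K) → K) (a : Fin n → K) :
    sigmaOp q i j (sigmaOp q k l f) a = sigmaOp q k l (sigmaOp q i j f) a := by
  have hs : (a ∘ Equiv.swap i j) ∘ Equiv.swap k l = (a ∘ Equiv.swap k l) ∘ Equiv.swap i j := by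
    funext p
    simp only [Function.comp_apply]
    congr 1
    simp only [Equiv.swap_apply_def]
    split_ifs <;> simp_all
  simp only [sigmaOp_apply, hs, Function.comp_apply, Equiv.swap_apply_of_ne_of_ne hik hil,
    Equiv.swap_apply_of_ne_of_ne hjk hjl, Equiv.swap_apply_of_ne_of_ne hik.symm hjk.symm,
    Equiv.swap_apply_of_ne_of_ne hil.symm hjl.symm]
  ring

theorem sigmaOp_entryOp_comm {i j k : Fin n} (hik : k ≠ i) (hjk : k ≠ j)
    (f : (Fin n → K) → K) (a : Fin n → K) :
    entryOp k (sigmaOp q i j f) a = sigmaOp q i j (entryOp k f) a := by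
  simp only [sigmaOp_apply, entryOp_apply, Function.comp_apply,
    Equiv.swap_apply_of_ne_of_ne hik hjk]
  ring

end Operators

/-! ### The seminormal representation -/

section Seminormal

variable {K : Type u} [Field K] {m n : ℕ} (q : K) (v : Fin m → K)

/-- The space of the seminormal representation: functions supported on content strings. -/
def contentModule (n : ℕ) {m : ℕ} (q : K) (v : Fin m → K) : Submodule K ((Fin n → K) → K) where
  carrier := {f | ∀ a, ¬ IsLocalContent q v a → f a = 0}
  add_mem' hf hg a ha := by rw [Pi.add_apply, hf a ha, hg a ha, add_zero]
  zero_mem' _ _ := rfl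
  smul_mem' t f hf a ha := by rw [Pi.smul_apply, hf a ha, smul_zero]

variable {q v}

/-- Relations need checking only at content strings, where the denominators that occur are nonzero
by `ne_succ` and `ne_succ_succ`. -/
theorem contentModule_ext {f g : contentModule n q v}
    (h : ∀ a, IsLocalContent q v a → f.1 a = g.1 a) : f = g := by
  refine Subtype.ext (funext fun a => ?_)
  by_cases ha : IsLocalContent q v a
  · exact h a ha
  · rw [f.2 a ha, g.2 a ha]

/-- At a string that is not a content string, either `offCoeff` vanishes or the transposed string is
not one either, because admissible transpositions preserve content strings. -/
theorem sigmaOp_mem {i j : Fin n} (hij : (i : ℕ) + 1 = j) :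
    ∀ f ∈ contentModule n q v, sigmaOp q i j f ∈ contentModule n q v := by
  intro f hf a ha
  rw [sigmaOp_apply, hf a ha, mul_zero, zero_add]
  by_cases h : a j = q ^ 2 * a i ∨ a i = q ^ 2 * a j
  · rw [offCoeff, if_pos h, zero_mul]
  · rw [not_or] at h
    rw [hf _ fun h' => ha ?_, mul_zero]
    have := h'.comp_swap hij (by simpa using h.2) (by simpa using h.1)
    rwa [comp_swap_comp_swap] at this

theorem entryOp_mem (i : Fin n) :
    ∀ f ∈ contentModule n q v, entryOp i f ∈ contentModule n q v := by
  intro f hf a ha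
  rw [entryOp_apply, hf a ha, mul_zero]

variable (q v)

/-- The action of `σ` at neighbouring positions on the space of the seminormal representation. -/
noncomputable def sigmaEnd (i j : Fin n) (hij : (i : ℕ) + 1 = j) :
    Module.End K (contentModule n q v) :=
  (sigmaOp q i j).restrict (sigmaOp_mem hij)

/-- The action of a Jucys–Murphy element on the space of the seminormal representation. -/
def entryEnd (i : Fin n) : Module.End K (contentModule n q v) :=
  (entryOp i).restrict (entryOp_mem i)

/-- The action of the generators of the Hecke algebra in the seminormal representation. -/
noncomputable def seminormalGen (hn : 0 < n) : Gen n → Module.End K (contentModule n q v)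
  | Gen.tau => entryEnd q v ⟨0, hn⟩
  | Gen.sigma i => sigmaEnd q v ⟨i, by omega⟩ ⟨i + 1, by omega⟩ rfl

theorem seminormalGen_tau (hn : 0 < n) (f : contentModule n q v) (a : Fin n → K) :
    (seminormalGen q v hn Gen.tau f).1 a = a ⟨0, hn⟩ * f.1 a := rfl

theorem seminormalGen_sigma (hn : 0 < n) (i : Fin (n - 1)) (f : contentModule n q v) :
    (seminormalGen q v hn (Gen.sigma i) f).1 =
      sigmaOp q ⟨i, by omega⟩ ⟨i + 1, by omega⟩ f.1 := rfl

variable {q v}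

theorem prod_ofFn_seminormalGen_tau (hn : 0 < n) {l : ℕ} (w : Fin l → K)
    (f : contentModule n q v) (a : Fin n → K) :
    ((List.ofFn fun k => seminormalGen q v hn Gen.tau -
      algebraMap K (Module.End K (contentModule n q v)) (w k)).prod f).1 a =
        (∏ k, (a ⟨0, hn⟩ - w k)) * f.1 a := by
  induction l with
  | zero => simp
  | succ l ih =>
    rw [List.ofFn_succ, List.prod_cons, Module.End.mul_apply, LinearMap.sub_apply,
      Module.algebraMap_end_apply, Submodule.coe_sub, Pi.sub_apply, Submodule.coe_smul,
      Pi.smul_apply, seminormalGen_tau, ih, Fin.prod_univ_succ, smul_eq_mul]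
    ring

theorem seminormalGen_rel (hg : IsGeneric n q v) (hn : 0 < n) {x y : FreeAlgebra K (Gen n)}
    (h : Rel n q v x y) : FreeAlgebra.lift K (seminormalGen q v hn) x =
      FreeAlgebra.lift K (seminormalGen q v hn) y := by
  have hq := hg.q_ne_zero
  have lt : FreeAlgebra.lift K (seminormalGen q v hn) (freeTau K n) =
    seminormalGen q v hn Gen.tau := FreeAlgebra.lift_ι_apply _ _
  have ls : ∀ i, FreeAlgebra.lift K (seminormalGen q v hn) (freeSigma K i) =
    seminormalGen q v hn (Gen.sigma i) := fun i => FreeAlgebra.lift_ι_apply _ _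
  have hne : ∀ {i j : ℕ} (hi : i < n) (hj : j < n), i ≠ j → (⟨i, hi⟩ : Fin n) ≠ ⟨j, hj⟩ :=
    fun _ _ h h' => h (Fin.ext_iff.1 h')
  refine LinearMap.ext fun f => contentModule_ext fun a ha => ?_
  cases h with
  | braid i j h =>
    obtain ⟨j, hj⟩ := j
    obtain rfl : (i : ℕ) + 1 = j := h
    simp only [map_mul, ls, Module.End.mul_apply, seminormalGen_sigma]
    exact sigmaOp_braid hq (hne _ _ (by omega)) (hne _ _ (by omega)) (hne _ _ (by omega)) _
      (ha.ne_succ rfl) (ha.ne_succ rfl) (ha.ne_succ_succ hg (j := ⟨i + 1, by omega⟩) rfl rfl)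
  | far_comm i j h =>
    simp only [map_mul, ls, Module.End.mul_apply, seminormalGen_sigma]
    exact sigmaOp_comm (hne _ _ (by omega)) (hne _ _ (by omega)) (hne _ _ (by omega))
      (hne _ _ (by omega)) _ _
  | tau_braid i h =>
    obtain ⟨i, hi⟩ := i
    obtain rfl : i = 0 := h
    -- The operator `σ₁ τ σ₁` multiplies by the second entry, so it commutes with `τ`, which
    -- multiplies by the first.
    have key : ∀ f : contentModule n q v, ∀ a, IsLocalContent q v a →
        (seminormalGen q v hn (Gen.sigma ⟨0, hi⟩) (seminormalGen q v hn Gen.tau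
          (seminormalGen q v hn (Gen.sigma ⟨0, hi⟩) f))).1 a = a ⟨1, by omega⟩ * f.1 a :=
      fun f a ha => sigmaOp_entryOp_sigmaOp hq f.1 (ha.ne_succ rfl)
    simp only [map_mul, ls, lt, Module.End.mul_apply]
    rw [key _ _ ha, seminormalGen_tau, seminormalGen_tau, key _ _ ha]
    ring
  | tau_comm i h =>
    simp only [map_mul, ls, lt, Module.End.mul_apply]
    exact sigmaOp_entryOp_comm (hne _ _ (by omega)) (hne _ _ (by omega)) _ _
  | quadratic i =>
    simp only [map_add, map_smul, map_one, ls, pow_two, map_mul]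
    exact sigmaOp_sigmaOp hq f.1 (ha.ne_succ (i := ⟨i, by omega⟩) (j := ⟨i + 1, by omega⟩) rfl)
  | cyclotomic =>
    simp only [map_list_prod, List.map_ofFn, Function.comp_def, map_sub, AlgHom.commutes, lt,
      map_zero]
    rw [prod_ofFn_seminormalGen_tau]
    have : a ⟨0, hn⟩ ∈ Set.range v := by
      rcases ha.start ⟨0, hn⟩ with h | ⟨i, hi, -⟩
      · exact h
      · exact absurd hi (Nat.not_lt_zero _)
    obtain ⟨k, hk⟩ := this
    rw [Finset.prod_eq_zero (Finset.mem_univ k) (by rw [hk, sub_self]), zero_mul]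
    rfl

/-- The seminormal representation of the cyclotomic Hecke algebra on functions of content
strings; it is the sum of the seminormal representations of all `m`-partitions of `n`. -/
noncomputable def seminormal (hg : IsGeneric n q v) (hn : 0 < n) :
    HeckeAlgebra n q v →ₐ[K] Module.End K (contentModule n q v) :=
  RingQuot.liftAlgHom K ⟨FreeAlgebra.lift K (seminormalGen q v hn), fun _ _ h =>
    seminormalGen_rel hg hn h⟩

theorem seminormal_tau (hg : IsGeneric n q v) (hn : 0 < n) :
    seminormal hg hn (tau q v) = seminormalGen q v hn Gen.tau := by
  rw [seminormal, tau, RingQuot.liftAlgHom_mkAlgHom_apply]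
  exact FreeAlgebra.lift_ι_apply _ _

theorem seminormal_sigma (hg : IsGeneric n q v) (hn : 0 < n) (i : Fin (n - 1)) :
    seminormal hg hn (sigma q v i) = seminormalGen q v hn (Gen.sigma i) := by
  rw [seminormal, sigma, RingQuot.liftAlgHom_mkAlgHom_apply]
  exact FreeAlgebra.lift_ι_apply _ _

theorem seminormal_jucysMurphy (hg : IsGeneric n q v) (hn : 0 < n) (i : ℕ) (hi : i < n) :
    seminormal hg hn (jucysMurphy q v i hi) = entryEnd q v ⟨i, hi⟩ := by
  induction i with
  | zero => exact seminormal_tau hg hn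
  | succ i ih =>
    rw [jucysMurphy_succ, map_mul, map_mul, ih, seminormal_sigma]
    refine LinearMap.ext fun f => contentModule_ext fun a ha => ?_
    exact sigmaOp_entryOp_sigmaOp hg.q_ne_zero f.1 (ha.ne_succ rfl)

/-- The basis vector of the seminormal representation at a content string. -/
noncomputable def contentVector (a : Fin n → K) (ha : IsLocalContent q v a) :
    contentModule n q v :=
  open Classical in
  ⟨Pi.single a 1, fun b hb => Pi.single_eq_of_ne (fun h => hb (by rwa [h])) _⟩

theorem contentVector_self {a : Fin n → K} (ha : IsLocalContent q v a) :
    (contentVector a ha).1 a = 1 := by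
  simp [contentVector]

theorem contentVector_of_ne {a b : Fin n → K} (ha : IsLocalContent q v a) (h : b ≠ a) :
    (contentVector a ha).1 b = 0 := by
  simp [contentVector, h]

theorem contentVector_ne_zero {a : Fin n → K} (ha : IsLocalContent q v a) :
    contentVector a ha ≠ 0 := by
  intro h
  have h2 := contentVector_self ha
  rw [h] at h2
  exact zero_ne_one h2

theorem finite_isLocalContent (hq : q ≠ 0) : {a : Fin n → K | IsLocalContent q v a}.Finite := by
  have hfin : (Set.image2 (fun (k : Fin m) (z : ℤ) => v k * q ^ (2 * z)) Set.univ
      (Set.Icc (-n : ℤ) n)).Finite := Set.Finite.image2 _ Set.finite_univ (Set.finite_Icc _ _)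
  refine (Set.Finite.pi' fun _ : Fin n => hfin).subset fun a ha j => ?_
  obtain ⟨k, z, hz, e⟩ := ha.exists_entry hq j
  have := hz.trans (Int.ofNat_le.2 j.2.le)
  exact ⟨k, trivial, z, abs_le.1 this, e.symm⟩

theorem span_contentVector (hq : q ≠ 0) : Submodule.span K
    (Set.range fun a : {a : Fin n → K // IsLocalContent q v a} => contentVector a.1 a.2) = ⊤ := by
  classical
  have : Fintype {a : Fin n → K // IsLocalContent q v a} := (finite_isLocalContent hq).fintype
  refine eq_top_iff.2 fun f _ => ?_
  have hf : f = ∑ a : {a : Fin n → K // IsLocalContent q v a}, f.1 a.1 • contentVector a.1 a.2 := by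
    refine contentModule_ext fun b hb => ?_
    rw [Submodule.coe_sum, Finset.sum_apply, Finset.sum_eq_single ⟨b, hb⟩]
    · rw [Submodule.coe_smul, Pi.smul_apply, contentVector_self, smul_eq_mul, mul_one]
    · intro a _ hab
      rw [Submodule.coe_smul, Pi.smul_apply,
        contentVector_of_ne _ (fun h => hab (Subtype.ext h.symm)), smul_zero]
    · simp
  rw [hf]
  exact Submodule.sum_mem _ fun a _ => Submodule.smul_mem _ _ (Submodule.subset_span ⟨a, rfl⟩)

theorem finiteDimensional_contentModule (hq : q ≠ 0) :
    FiniteDimensional K (contentModule n q v) := by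
  have : Finite {a : Fin n → K // IsLocalContent q v a} := finite_isLocalContent hq
  refine Module.finite_def.2 ?_
  rw [← span_contentVector hq]
  exact Submodule.fg_span (Set.finite_range _)

theorem entryOp_contentVector {a : Fin n → K} (ha : IsLocalContent q v a) (i : Fin n) :
    entryEnd q v i (contentVector a ha) = a i • contentVector a ha := by
  refine contentModule_ext fun b _ => ?_
  change b i * (contentVector a ha).1 b = a i * (contentVector a ha).1 b
  by_cases h : b = a
  · rw [h]
  · rw [contentVector_of_ne ha h, mul_zero, mul_zero]

/-- The functions supported on a content string and its transposition, if the latter is linked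
to it by the action of `σ`. -/
def linkedSubmodule (q : K) (v : Fin m → K) (i j : Fin n) (a : Fin n → K) :
    Submodule K (contentModule n q v) where
  carrier := {f | ∀ b, b ≠ a → (b = a ∘ Equiv.swap i j → offCoeff q (a i) (a j) = 0) → f.1 b = 0}
  add_mem' hf hg b h1 h2 := by
    rw [Submodule.coe_add, Pi.add_apply, hf b h1 h2, hg b h1 h2, add_zero]
  zero_mem' _ _ _ := rfl
  smul_mem' t f hf b h1 h2 := by rw [Submodule.coe_smul, Pi.smul_apply, hf b h1 h2, smul_zero]

theorem sigmaOp_mem_linkedSubmodule (hq : q ≠ 0) {i j : Fin n} (hij : (i : ℕ) + 1 = j)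
    {a : Fin n → K} {f : contentModule n q v} (hf : f ∈ linkedSubmodule q v i j a) :
    sigmaEnd q v i j hij f ∈ linkedSubmodule q v i j a := by
  intro b h1 h2
  change sigmaOp q i j f.1 b = 0
  rw [sigmaOp_apply, hf b h1 h2, mul_zero, zero_add]
  by_cases h3 : b = a ∘ Equiv.swap i j
  · have h4 := offCoeff_eq_zero_comm hq (h2 h3)
    rw [h3]
    simp only [Function.comp_apply, Equiv.swap_apply_left, Equiv.swap_apply_right, h4, zero_mul]
  · rw [hf, mul_zero]
    · intro h; exact h3 (by rw [← h, comp_swap_comp_swap])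
    · intro h
      refine absurd ?_ h1
      rw [← comp_swap_comp_swap b i j, h, comp_swap_comp_swap]

theorem entryOp_mem_linkedSubmodule {i j k : Fin n} {a : Fin n → K} {f : contentModule n q v}
    (hf : f ∈ linkedSubmodule q v i j a) :
    entryEnd q v k f ∈ linkedSubmodule q v i j a := by
  intro b h1 h2
  change entryOp k f.1 b = 0
  rw [entryOp_apply, hf b h1 h2, mul_zero]

/-- Any invariant subspace containing a nonzero vector linked to a content string contains the
basis vector of that string. -/
theorem contentVector_mem_of_mem {i j : Fin n} (hij : (i : ℕ) + 1 = j)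
    {a : Fin n → K} (ha : IsLocalContent q v a) {f : contentModule n q v}
    (hf : f ∈ linkedSubmodule q v i j a) (hf0 : f ≠ 0) (hSf : sigmaEnd q v i j hij f ∈
      linkedSubmodule q v i j a) {N : Submodule K (contentModule n q v)}
    (hX : ∀ x ∈ N, entryEnd q v i x ∈ N) (hS : ∀ x ∈ N, sigmaEnd q v i j hij x ∈ N)
    (hfN : f ∈ N) : contentVector a ha ∈ N := by
  -- Subtracting `a j` from `J_i` kills the component at the transposed string, whose `i`-th entry
  -- is `a j`, and scales the component at `a` by `a i - a j ≠ 0`.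
  have hgen : ∀ f ∈ N, f ∈ linkedSubmodule q v i j a → f.1 a ≠ 0 → contentVector a ha ∈ N := by
    intro f hfN hf h0
    have hd : (a i - a j) * f.1 a ≠ 0 := mul_ne_zero (sub_ne_zero.2 (ha.ne_succ hij)) h0
    have e : contentVector a ha =
        ((a i - a j) * f.1 a)⁻¹ • (entryEnd q v i f - a j • f) := by
      refine contentModule_ext fun b hb => ?_
      change _ = ((a i - a j) * f.1 a)⁻¹ * (b i * f.1 b - a j * f.1 b)
      by_cases hba : b = a
      · rw [hba, contentVector_self, ← sub_mul, inv_mul_cancel₀ hd]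
      · rw [contentVector_of_ne ha hba]
        by_cases hba' : b = a ∘ Equiv.swap i j
        · simp [hba']
        · rw [hf b hba fun h => absurd h hba', mul_zero, mul_zero, sub_zero, mul_zero]
    rw [e]
    exact N.smul_mem _ (N.sub_mem (hX _ hfN) (N.smul_mem _ hfN))
  by_cases h0 : f.1 a = 0
  -- A nonzero `f` vanishing at `a` lives on the transposed string, linked by a nonzero coefficient;
  -- `σ` then produces a vector that does not vanish at `a`.
  · have hne : f.1 (a ∘ Equiv.swap i j) ≠ 0 ∧ offCoeff q (a i) (a j) ≠ 0 := by
      by_contra hcon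
      refine hf0 (contentModule_ext fun b _ => ?_)
      by_cases hba : b = a
      · rw [hba, h0]; rfl
      by_cases hb0 : f.1 b = 0
      · exact hb0
      refine hf b hba fun hb => ?_
      by_contra hc
      exact hcon ⟨hb ▸ hb0, hc⟩
    refine hgen _ (hS f hfN) hSf ?_
    change sigmaOp q i j f.1 a ≠ 0
    rw [sigmaOp_apply, h0, mul_zero, zero_add]
    exact mul_ne_zero hne.2 hne.1
  · exact hgen f hfN hf h0

theorem isCRepresentation_seminormal (hg : IsGeneric n q v) (hn : 0 < n) :
    IsCRepresentation (seminormal hg hn) where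
  diagonalizable i hi := by
    rw [eq_top_iff, ← span_contentVector hg.q_ne_zero, Submodule.span_le]
    rintro _ ⟨⟨a, ha⟩, rfl⟩
    refine Submodule.mem_iSup_of_mem (a ⟨i, hi⟩) (Module.End.mem_eigenspace_iff.2 ?_)
    rw [seminormal_jucysMurphy]
    exact entryOp_contentVector ha _
  completely_reducible i hi := by
    rw [seminormal_jucysMurphy, seminormal_jucysMurphy, seminormal_sigma]
    have hij : ((⟨i, by omega⟩ : Fin n) : ℕ) + 1 = (⟨i + 1, hi⟩ : Fin n) := rfl
    have hinv : ∀ a, ∀ f ∈ linkedSubmodule q v _ _ a,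
        sigmaEnd q v _ _ hij f ∈ linkedSubmodule q v _ _ a := fun a f hf =>
      sigmaOp_mem_linkedSubmodule hg.q_ne_zero hij hf
    refine isSemisimpleModule_adjoin _
      (fun a : {a : Fin n → K // IsLocalContent q v a} => contentVector a.1 a.2)
      (fun a => linkedSubmodule q v ⟨i, by omega⟩ ⟨i + 1, hi⟩ a.1)
      (span_contentVector hg.q_ne_zero) ?_ ?_ ?_ ?_
    · rintro a T (rfl | rfl | rfl) x hx
      · exact entryOp_mem_linkedSubmodule hx
      · exact entryOp_mem_linkedSubmodule hx
      · exact hinv _ _ hx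
    · exact fun a b hb _ => contentVector_of_ne a.2 hb
    · exact fun a => contentVector_ne_zero a.2
    · exact fun a f hf hf0 N hN hfN => contentVector_mem_of_mem hij a.2 hf hf0 (hinv _ _ hf)
        (hN _ (by simp)) (hN _ (Or.inr (Or.inr rfl))) hfN

theorem mem_jmSpec_of_isLocalContent (hg : IsGeneric n q v) (hn : 0 < n) {a : Fin n → K}
    (ha : IsLocalContent q v a) : a ∈ jmSpec n q v := by
  refine ⟨contentModule n q v, inferInstance, inferInstance,
    finiteDimensional_contentModule hg.q_ne_zero, seminormal hg hn,
    isCRepresentation_seminormal hg hn, contentVector a ha, contentVector_ne_zero ha, fun i => ?_⟩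
  rw [seminormal_jucysMurphy]
  exact entryOp_contentVector ha i

end Seminormal

end CyclotomicHecke

theorem mainTheorem5 {K : Type u} [Field K] (m n : ℕ) (hn : 0 < n) (q : K) (v : Fin m → K)
    (hq0 : q ≠ 0) (hq1 : q ^ 2 ≠ 1)
    (h1 : ∀ N : ℕ, N < n → ∑ i ∈ Finset.range (N + 1), q ^ (2 * i) ≠ 0)
    (h2 : ∀ i : ℤ, -(n : ℤ) < i → i < (n : ℤ) → ∀ j k : Fin m, j ≠ k →
      q ^ (2 * i) * v j - v k ≠ 0)
    (h3 : ∀ j : Fin m, v j ≠ 0) :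
    CyclotomicHecke.jmSpec n q v = CyclotomicHecke.contentStrings n q v ∧
    Set.BijOn (CyclotomicHecke.StandardTableau.contentString q v)
      (Set.univ : Set (CyclotomicHecke.StandardTableau m n))
      (CyclotomicHecke.contentStrings n q v) ∧
    Set.BijOn (CyclotomicHecke.StandardTableau.contentString q v)
      (Set.univ : Set (CyclotomicHecke.StandardTableau m n))
      (CyclotomicHecke.jmSpec n q v) := by
  have hg := CyclotomicHecke.IsGeneric.of_sum_ne_zero hq0 hq1 h1 h2 h3
  have hcont : CyclotomicHecke.contentStrings n q v = {a | CyclotomicHecke.IsLocalContent q v a} :=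
    Set.ext fun a => CyclotomicHecke.isContentString_iff hg a
  have hspec : CyclotomicHecke.jmSpec n q v = {a | CyclotomicHecke.IsLocalContent q v a} :=
    Set.ext fun a => ⟨CyclotomicHecke.isLocalContent_of_mem_jmSpec hg,
      CyclotomicHecke.mem_jmSpec_of_isLocalContent hg hn⟩
  have hbij := CyclotomicHecke.StandardTableau.bijOn_contentString hg hn
  rw [hcont, hspec]
  exact ⟨rfl, hbij, hbij⟩
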